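/- Let $A=\bigoplus_{i\in\mathbb Z}A^i$ be a dg ring (cohomological grading, $d$ of degree $+1$), and let $\mathrm{dgMod}\,A$ be the abelian category of right dg $A$-modules, whose morphisms are the $A$-linear maps of degree $0$ commuting with the differentials. Assume that $A$ is bounded ($A^i=0$ for $|i|\gg0$), non-positive ($A^i=0$ for $i>0$) and right dg noetherian (every ascending chain of right dg ideals, i.e. homogeneous right ideals closed under $d$, is stationary). Let $\mathrm{Mod}\,A^0$ be the category of right $A^0$-modules. For an abelian category $\mathcal A$, a nonzero object $H$ is called monoform if for every nonzero subobject $L\subseteq H$ the objects $H$ and $H/L$ have no common nonzero subobject (up to isomorphism). Two monoform objects are atom-equivalent if they have a common nonzero subobject. $\operatorname{Spec}\mathcal A$ is the collection of the classes $\overline H$ of monoform objects under atom-equivalence. For an object $M$ put $\operatorname{Supp}_{\mathcal A}M=\{\overline H\mid H \text{ is a monoform subquotient of } M\}$; these sets form an open basis of a topology on $\operatorname{Spec}\mathcal A$. Let $\mathbb Z$ act on $\operatorname{Spec}(\mathrm{dgMod}\,A)$ by $n\cdot\overline H=\overline{H[n]}$, let $\pi\colon\operatorname{Spec}(\mathrm{dgMod}\,A)\to\operatorname{Spec}^{\mathbb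 Z}(\mathrm{dgMod}\,A)$ be the projection onto the orbit space with the quotient topology, and put $\operatorname{Supp}^{\mathbb Z}M=\pi(\operatorname{Supp}_{\mathrm{dgMod}\,A}M)$. For a right $A^0$-module $M$ let $D(M)$ be the dg $A$-module with $D(M)^{-1}=D(M)^0=M$, all other components zero, and differential $\mathrm{id}_M\colon D(M)^{-1}\to D(M)^0$; for $a\in A^i$ and $x\in D(M)^j$, the action is $x\cdot a=xa$ if $i=0$, $x\cdot a=x\,d(a)\in D(M)^{-1}$ if $i=-1$ and $j=0$, and $x\cdot a=0$ otherwise. Then: 1. For every monoform object $H$ of $\mathrm{Mod}\,A^0$ and every $n\in\mathbb Z$, the dg module $D(H)[n]$ is monoform, and $$\operatorname{Spec}(\mathrm{Mod}\,A^0)\times\mathbb Z\to\operatorname{Spec}(\mathrm{dgMod}\,A),\qquad(\overline H,n)\mapsto\overline{D(H)[n]}$$ is a well-defined bijection. 2. The induced map $\operatorname{Spec}(\mathrm{Mod}\,A^0)\to\operatorname{Spec}^{\mathbb Z}(\mathrm{dgMod}\,A)$, $\overline H\mapsto\pi(\overline{D(H)})$, is a bijection and a homeomorphism. Its inverse sends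 $\pi(\overline{D(H)[n]})$ to $\overline H$ for every $n\in\mathbb Z$. 3. Under this homeomorphism, for every dg $A$-module $M$, $\operatorname{Supp}^{\mathbb Z}M=\operatorname{Supp}_{\mathrm{Mod}\,A^0}M$, where on the right $M$ is regarded as an $A^0$-module by forgetting the differential and the grading. -/

import Mathlib

open CategoryTheory Limits

universe v u

section Atoms

variable {C : Type u} [Category.{v} C]

/-- `X` and `Y` have a common nonzero subobject (up to isomorphism). -/
def HaveCommonNonzeroSubobject (X Y : C) : Prop :=
  ∃ (Z : C) (i : Z ⟶ X) (j : Z ⟶ Y), Mono i ∧ Mono j ∧ ¬ IsZero Z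

/-- `H` is a subquotient of `M`, i.e. a quotient of a subobject of `M`. -/
def IsSubquotient (H M : C) : Prop :=
  ∃ (L : C) (i : L ⟶ M) (p : L ⟶ H), Mono i ∧ Epi p

variable [Abelian C]

/-- A monoform object: a nonzero object `H` such that for every nonzero subobject `L` of `H`
there is no common nonzero subobject of `H` and `H / L`. -/
structure IsMonoform (H : C) : Prop where
  not_isZero : ¬ IsZero H
  not_common : ∀ (L : C) (i : L ⟶ H) [Mono i], ¬ IsZero L →
    ¬ HaveCommonNonzeroSubobject H (cokernel i)

/-- Two nonzero subobjects of a monoform object have a nonzero intersection. -/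
lemma IsMonoform.pullback_not_isZero {H L L' : C} (hH : IsMonoform H) (i : L ⟶ H) (j : L' ⟶ H)
    [Mono i] [Mono j] (hL : ¬ IsZero L) (hL' : ¬ IsZero L') : ¬ IsZero (pullback i j) := by
  intro h0
  refine hH.not_common L i hL ⟨L', j, j ≫ cokernel.π i, inferInstance, ?_, hL'⟩
  refine Preadditive.mono_of_cancel_zero _ fun {P} g hg => ?_
  rw [← Category.assoc] at hg
  let l := Abelian.monoLift i (g ≫ j) hg
  have hl : l ≫ i = g ≫ j := Abelian.monoLift_comp i (g ≫ j) hg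
  rw [← pullback.lift_snd l g hl, h0.eq_of_tgt (pullback.lift l g hl) 0, zero_comp]

variable (C) in
/-- The monoform objects of `C`. -/
def MonoformObj : Type u := {H : C // IsMonoform H}

/-- Atom-equivalence of monoform objects. -/
instance atomSetoid : Setoid (MonoformObj C) where
  r H K := HaveCommonNonzeroSubobject H.1 K.1
  iseqv :=
    { refl := fun H => ⟨H.1, 𝟙 _, 𝟙 _, inferInstance, inferInstance, H.2.not_isZero⟩
      symm := fun ⟨Z, i, j, hi, hj, h⟩ => ⟨Z, j, i, hj, hi, h⟩
      trans := by
        rintro H K L ⟨Z, i, j, hi, hj, hZ⟩ ⟨W, k, l, hk, hl, hW⟩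
        exact ⟨pullback j k, pullback.fst j k ≫ i, pullback.snd j k ≫ l,
          inferInstance, inferInstance, K.2.pullback_not_isZero j k hZ hW⟩ }

variable (C) in
/-- The atom spectrum `Spec C`: atom-equivalence classes of monoform objects. -/
def AtomSpectrum : Type u := Quotient (atomSetoid (C := C))

/-- The class of a monoform object in the atom spectrum. -/
def AtomSpectrum.mk (H : C) (hH : IsMonoform H) : AtomSpectrum C :=
  Quotient.mk atomSetoid ⟨H, hH⟩

/-- The atom support of `M`: the classes of the monoform subquotients of `M`. -/
def atomSupp (M : C) : Set (AtomSpectrum C) :=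
  {α | ∃ (H : C) (hH : IsMonoform H), α = AtomSpectrum.mk H hH ∧ IsSubquotient H M}

/-- The topology on the atom spectrum with the atom supports as open basis. -/
instance : TopologicalSpace (AtomSpectrum C) :=
  TopologicalSpace.generateFrom (Set.range (atomSupp (C := C)))

lemma HaveCommonNonzeroSubobject.map {D : Type*} [Category* D] [Abelian D] {X Y : C}
    (F : C ⥤ D) [F.IsEquivalence] (h : HaveCommonNonzeroSubobject X Y) :
    HaveCommonNonzeroSubobject (F.obj X) (F.obj Y) := by
  obtain ⟨Z, i, j, hi, hj, hZ⟩ := h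
  refine ⟨F.obj Z, F.map i, F.map j, inferInstance, inferInstance, fun h => hZ ?_⟩
  exact (F.inv.map_isZero h).of_iso (F.asEquivalence.unitIso.app Z)

lemma IsMonoform.of_iso {H K : C} (hH : IsMonoform H) (e : H ≅ K) : IsMonoform K where
  not_isZero h := hH.not_isZero (h.of_iso e)
  not_common L i _ hL := by
    rintro ⟨Z, a, b, _, _, hZ⟩
    refine hH.not_common L (i ≫ e.inv) hL
      ⟨Z, a ≫ e.inv, b ≫ (cokernelCompIsIso i e.inv).inv, inferInstance, inferInstance, hZ⟩

lemma IsMonoform.map {D : Type*} [Category* D] [Abelian D] {H : C} (hH : IsMonoform H)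
    (F : C ⥤ D) [F.IsEquivalence] : IsMonoform (F.obj H) where
  not_isZero h := hH.not_isZero
    ((F.inv.map_isZero h).of_iso (F.asEquivalence.unitIso.app H))
  not_common L i _ hL := by
    intro h
    have hH' : IsMonoform (F.inv.obj (F.obj H)) := hH.of_iso (F.asEquivalence.unitIso.app H)
    refine hH'.not_common (F.inv.obj L) (F.inv.map i)
      (fun h' => hL ((F.map_isZero h').of_iso (F.asEquivalence.counitIso.app L).symm)) ?_
    obtain ⟨Z, a, b, _, _, hZ⟩ := h.map F.inv
    exact ⟨Z, a, b ≫ (PreservesCokernel.iso F.inv i).hom, inferInstance, inferInstance, hZ⟩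

/-! ### The action of shift functors and the orbit atom spectrum -/

variable {G : Type*} [AddGroup G] [HasShift C G]

/-- The action of `g` on the atom spectrum, sending the class of `H` to the class of `H⟦g⟧`. -/
def AtomSpectrum.shift (g : G) : AtomSpectrum C → AtomSpectrum C :=
  Quotient.map (fun H => ⟨H.1⟦g⟧, H.2.map (shiftFunctor C g)⟩)
    fun _ _ h => HaveCommonNonzeroSubobject.map (shiftFunctor C g) h

lemma AtomSpectrum.mk_eq_of_iso {H K : C} (hH : IsMonoform H) (hK : IsMonoform K) (e : H ≅ K) :
    AtomSpectrum.mk H hH = AtomSpectrum.mk K hK :=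
  Quotient.sound ⟨H, 𝟙 _, e.hom, inferInstance, inferInstance, hH.not_isZero⟩

instance {G : Type*} [AddCommGroup G] [HasShift C G] : AddAction G (AtomSpectrum C) where
  vadd g α := α.shift g
  zero_vadd := by
    rintro ⟨H⟩
    exact AtomSpectrum.mk_eq_of_iso _ H.2 ((shiftFunctorZero C G).app H.1)
  add_vadd g h := by
    rintro ⟨H⟩
    exact AtomSpectrum.mk_eq_of_iso _ ((H.2.map (shiftFunctor C h)).map (shiftFunctor C g))
      ((shiftFunctorAdd' C h g (g + h) (add_comm h g)).app H.1)

variable (C) in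
/-- The orbit atom spectrum: the quotient of the atom spectrum by the action of `G`. -/
def OrbitAtomSpectrum (G : Type*) [AddCommGroup G] [HasShift C G] : Type u :=
  Quotient (AddAction.orbitRel G (AtomSpectrum C))

/-- The quotient topology on the orbit atom spectrum. -/
instance (G : Type*) [AddCommGroup G] [HasShift C G] : TopologicalSpace (OrbitAtomSpectrum C G) :=
  inferInstanceAs (TopologicalSpace (Quotient (AddAction.orbitRel G (AtomSpectrum C))))

/-- The projection from the atom spectrum to the orbit atom spectrum. -/
def orbitProj (G : Type*) [AddCommGroup G] [HasShift C G] (α : AtomSpectrum C) :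
    OrbitAtomSpectrum C G :=
  Quotient.mk (AddAction.orbitRel G (AtomSpectrum C)) α

/-- The support of `M` in the orbit atom spectrum. -/
def orbitSupp (G : Type*) [AddCommGroup G] [HasShift C G] (M : C) : Set (OrbitAtomSpectrum C G) :=
  orbitProj G '' atomSupp M

end Atoms

/-! ### Dg rings and dg modules -/

section DG

open DirectSum MulOpposite

/-- A dg ring: a `ℤ`-graded ring with a differential of degree `1` which satisfies the graded
Leibniz rule. -/
structure DGRing : Type (u + 1) where
  carrier : Type u
  [ring : Ring carrier]
  gr : ℤ → AddSubgroup carrier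
  [gradedRing : GradedRing gr]
  d : carrier →+ carrier
  d_mem : ∀ (i : ℤ) (a : carrier), a ∈ gr i → d a ∈ gr (i + 1)
  d_d : ∀ a, d (d a) = 0
  leibniz : ∀ (i : ℤ) (a b : carrier), a ∈ gr i →
    d (a * b) = d a * b + i.negOnePow • (a * d b)

attribute [instance] DGRing.ring DGRing.gradedRing

namespace DGRing

variable (A : DGRing.{u})

/-- The underlying graded ring is bounded: `A^i = 0` for `|i|` large. -/
def IsBounded : Prop := ∃ N : ℤ, ∀ i : ℤ, N < |i| → A.gr i = ⊥

/-- `A^i = 0` for `i > 0`. -/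
def IsNonpositive : Prop := ∀ i : ℤ, 0 < i → A.gr i = ⊥

/-- A right dg ideal: a homogeneous right ideal which is closed under the differential. -/
structure IsRightDGIdeal (I : Submodule A.carrierᵐᵒᵖ A.carrier) : Prop where
  proj_mem : ∀ (i : ℤ) (a : A.carrier), a ∈ I → (decompose A.gr a i : A.carrier) ∈ I
  d_mem : ∀ a ∈ I, A.d a ∈ I

/-- Every ascending chain of right dg ideals is stationary. -/
def IsRightDGNoetherian : Prop :=
  ∀ I : ℕ → Submodule A.carrierᵐᵒᵖ A.carrier, Monotone I → (∀ n, A.IsRightDGIdeal (I n)) →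
    ∃ n, ∀ m, n ≤ m → I m = I n

/-- The ring `A^0`. -/
abbrev degZero : Type u := SetLike.GradeZero.subring A.gr

/-- The inclusion of rings from `A^0` to `A`. -/
def degZeroInclusion : A.degZero →+* A.carrier := (SetLike.GradeZero.subring A.gr).subtype

end DGRing

/-- A right dg module over `A`. The right action of `a` on `x` is `op a • x`. -/
structure DGMod (A : DGRing.{u}) : Type (u + 1) where
  carrier : Type u
  [addCommGroup : AddCommGroup carrier]
  [module : Module A.carrierᵐᵒᵖ carrier]
  gr : ℤ → AddSubgroup carrier
  isInternal : DirectSum.IsInternal gr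
  smul_mem : ∀ (i j : ℤ) (x : carrier) (a : A.carrier), x ∈ gr i → a ∈ A.gr j →
    op a • x ∈ gr (i + j)
  d : carrier →+ carrier
  d_mem : ∀ (i : ℤ) (x : carrier), x ∈ gr i → d x ∈ gr (i + 1)
  d_d : ∀ x, d (d x) = 0
  leibniz : ∀ (i : ℤ) (x : carrier) (a : A.carrier), x ∈ gr i →
    d (op a • x) = op a • d x + i.negOnePow • (op (A.d a) • x)

attribute [instance] DGMod.addCommGroup DGMod.module

/-- A grading is internal once there are projections onto its pieces and the pieces generate. -/
lemma isInternal_of_proj {M : Type*} [AddCommGroup M] (gr : ℤ → AddSubgroup M)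
    (p : ℤ → M →+ M) (hp : ∀ i, ∀ x ∈ gr i, p i x = x)
    (hp' : ∀ i j, ∀ x ∈ gr i, i ≠ j → p j x = 0)
    (hs : ∀ x, ∃ s : Finset ℤ, (∀ i ∈ s, p i x ∈ gr i) ∧ x = ∑ i ∈ s, p i x) :
    DirectSum.IsInternal gr := by
  have key : ∀ (s : ⨁ i, gr i) (j : ℤ),
      p j (DirectSum.coeAddMonoidHom gr s) = s j := by
    intro s j
    induction s using DirectSum.induction_on with
    | zero => simp
    | of i x =>
      rw [DirectSum.coeAddMonoidHom_of]
      by_cases h : i = j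
      · subst h; simp [hp i x x.2]
      · rw [hp' i j x x.2 h, DirectSum.of_eq_of_ne _ _ _ (Ne.symm h)]; rfl
    | add x y hx hy => simp [hx, hy]
  constructor
  · rw [injective_iff_map_eq_zero]
    intro s hs0
    ext j
    rw [← key, hs0]; simp
  · intro x
    obtain ⟨s, h1, h2⟩ := hs x
    refine ⟨∑ i ∈ s.attach, DirectSum.of (fun i => gr i) i.1 ⟨p i.1 x, h1 _ i.2⟩, ?_⟩
    rw [map_sum]
    simp only [DirectSum.coeAddMonoidHom_of]
    rw [Finset.sum_attach s (fun i => p i x)]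
    exact h2.symm

namespace DGMod

variable {A : DGRing.{u}}

section Proj

variable (M : DGMod A)

/-- The projection of `M` onto its component of degree `i`. -/
noncomputable def proj (i : ℤ) : M.carrier →+ M.carrier :=
  letI := M.isInternal.chooseDecomposition
  { toFun := fun x => (decompose M.gr x i : M.carrier)
    map_zero' := by simp
    map_add' := by simp }

lemma proj_mem (i : ℤ) (x : M.carrier) : M.proj i x ∈ M.gr i :=
  letI := M.isInternal.chooseDecomposition
  (decompose M.gr x i).2

lemma proj_same {i : ℤ} {x : M.carrier} (hx : x ∈ M.gr i) : M.proj i x = x :=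
  letI := M.isInternal.chooseDecomposition
  decompose_of_mem_same M.gr hx

lemma proj_ne {i j : ℤ} {x : M.carrier} (hx : x ∈ M.gr i) (h : i ≠ j) : M.proj j x = 0 :=
  letI := M.isInternal.chooseDecomposition
  decompose_of_mem_ne M.gr hx h

lemma exists_sum_proj (x : M.carrier) :
    ∃ s : Finset ℤ, (∀ i, i ∉ s → M.proj i x = 0) ∧ x = ∑ i ∈ s, M.proj i x := by
  classical
  let _ := M.isInternal.chooseDecomposition
  refine ⟨(decompose M.gr x).support, fun i hi => ?_, (sum_support_decompose M.gr x).symm⟩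
  have : decompose M.gr x i = 0 := by simpa using hi
  change ((decompose M.gr x i : M.gr i) : M.carrier) = 0
  rw [this]; rfl

lemma sum_proj_of_subset {x : M.carrier} {s t : Finset ℤ} (hs : ∀ i, i ∉ s → M.proj i x = 0)
    (h : x = ∑ i ∈ s, M.proj i x) (hst : s ⊆ t) : x = ∑ i ∈ t, M.proj i x := by
  rw [← Finset.sum_subset hst fun i _ hi => hs i hi]; exact h

lemma mem_gr_of_proj {i : ℤ} {x : M.carrier} (h : ∀ j, j ≠ i → M.proj j x = 0) :
    x ∈ M.gr i := by
  obtain ⟨s, _, h2⟩ := M.exists_sum_proj x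
  rw [h2]
  refine AddSubgroup.sum_mem _ fun j _ => ?_
  by_cases hj : j = i
  · subst hj; exact M.proj_mem _ _
  · rw [h j hj]; exact zero_mem _

@[elab_as_elim]
lemma induction_gr {p : M.carrier → Prop} (x : M.carrier) (h0 : p 0)
    (hg : ∀ i, ∀ y ∈ M.gr i, p y) (ha : ∀ y z, p y → p z → p (y + z)) : p x := by
  let _ := M.isInternal.chooseDecomposition
  exact Decomposition.inductionOn M.gr h0 (fun {i} y => hg i y y.2) ha x

end Proj

/-- Morphisms of dg modules: `A`-linear maps of degree `0` which commute with the
differentials. -/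
@[ext]
structure Hom (M N : DGMod A) : Type u where
  toLin : M.carrier →ₗ[A.carrierᵐᵒᵖ] N.carrier
  map_gr : ∀ (i : ℤ) (x : M.carrier), x ∈ M.gr i → toLin x ∈ N.gr i
  map_d : ∀ x, toLin (M.d x) = N.d (toLin x)

/-- The category of right dg modules over `A`. -/
instance : Category (DGMod A) where
  Hom M N := Hom M N
  id M := ⟨LinearMap.id, fun _ _ h => h, fun _ => rfl⟩
  comp f g := ⟨g.toLin ∘ₗ f.toLin, fun i x h => g.map_gr i _ (f.map_gr i x h),
    fun x => by simp [f.map_d, g.map_d]⟩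

/-- The underlying linear map of a morphism. -/
def lin {M N : DGMod A} (f : M ⟶ N) : M.carrier →ₗ[A.carrierᵐᵒᵖ] N.carrier := Hom.toLin f

lemma lin_gr {M N : DGMod A} (f : M ⟶ N) {i : ℤ} {x : M.carrier} (h : x ∈ M.gr i) :
    lin f x ∈ N.gr i := Hom.map_gr f i x h

lemma lin_d {M N : DGMod A} (f : M ⟶ N) (x : M.carrier) : lin f (M.d x) = N.d (lin f x) :=
  Hom.map_d f x

@[ext]
lemma hom_ext {M N : DGMod A} {f g : M ⟶ N} (h : ∀ x, lin f x = lin g x) : f = g :=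
  Hom.ext (LinearMap.ext h)

@[simp] lemma lin_id (M : DGMod A) : lin (𝟙 M) = LinearMap.id := rfl

@[simp] lemma lin_comp {M N K : DGMod A} (f : M ⟶ N) (g : N ⟶ K) :
    lin (f ≫ g) = lin g ∘ₗ lin f := rfl

lemma lin_proj {M N : DGMod A} (f : M ⟶ N) (i : ℤ) (x : M.carrier) :
    lin f (M.proj i x) = N.proj i (lin f x) := by
  induction x using M.induction_gr with
  | h0 => simp
  | hg j y hy =>
    by_cases h : j = i
    · subst h; rw [M.proj_same hy, N.proj_same (lin_gr f hy)]
    · rw [M.proj_ne hy h, N.proj_ne (lin_gr f hy) h, map_zero]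
  | ha y z hy hz => simp [hy, hz]

instance (M N : DGMod A) : Zero (M ⟶ N) :=
  ⟨⟨0, fun i _ _ => zero_mem (N.gr i), fun x => by simp⟩⟩

instance (M N : DGMod A) : Add (M ⟶ N) :=
  ⟨fun f g => ⟨lin f + lin g, fun _ _ h => add_mem (lin_gr f h) (lin_gr g h),
    fun x => by simp [lin_d]⟩⟩

instance (M N : DGMod A) : Neg (M ⟶ N) :=
  ⟨fun f => ⟨-lin f, fun _ _ h => neg_mem (lin_gr f h), fun x => by simp [lin_d]⟩⟩

@[simp] lemma lin_zero (M N : DGMod A) : lin (0 : M ⟶ N) = 0 := rfl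

@[simp] lemma lin_add {M N : DGMod A} (f g : M ⟶ N) : lin (f + g) = lin f + lin g := rfl

@[simp] lemma lin_neg {M N : DGMod A} (f : M ⟶ N) : lin (-f) = -lin f := rfl

instance (M N : DGMod A) : AddCommGroup (M ⟶ N) where
  add_assoc f g h := hom_ext fun x => add_assoc (lin f x) (lin g x) (lin h x)
  zero_add f := hom_ext fun x => zero_add (lin f x)
  add_zero f := hom_ext fun x => add_zero (lin f x)
  neg_add_cancel f := hom_ext fun x => neg_add_cancel (lin f x)
  add_comm f g := hom_ext fun x => add_comm (lin f x) (lin g x)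
  nsmul := nsmulRec
  zsmul := zsmulRec

instance : Preadditive (DGMod A) where
  add_comp _ _ _ f g h := hom_ext fun x => by simp
  comp_add _ _ _ _ _ _ := rfl

/-- A dg submodule: a homogeneous submodule closed under the differential. -/
structure IsDGSubmodule (M : DGMod A) (S : Submodule A.carrierᵐᵒᵖ M.carrier) : Prop where
  proj_mem : ∀ (i : ℤ) (x : M.carrier), x ∈ S → M.proj i x ∈ S
  d_mem : ∀ x ∈ S, M.d x ∈ S

section SubQuot

variable (M : DGMod A) (S : Submodule A.carrierᵐᵒᵖ M.carrier) (hS : M.IsDGSubmodule S)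

/-- A dg submodule as a dg module. -/
def sub : DGMod A where
  carrier := S
  gr i := (M.gr i).comap S.subtype.toAddMonoidHom
  isInternal := by
    refine isInternal_of_proj _
      (fun i => ((M.proj i).comp S.subtype.toAddMonoidHom).codRestrict S.toAddSubgroup
        fun x => hS.proj_mem i x x.2) ?_ ?_ ?_
    · intro i x hx; exact Subtype.ext (M.proj_same hx)
    · intro i j x hx h; exact Subtype.ext (M.proj_ne hx h)
    · intro x
      obtain ⟨s, _, h2⟩ := M.exists_sum_proj x
      refine ⟨s, fun i _ => M.proj_mem i x, Subtype.ext ?_⟩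
      rw [AddSubmonoidClass.coe_finsetSum]
      exact h2
  smul_mem i j x a hx ha := M.smul_mem i j x a hx ha
  d := (M.d.comp S.subtype.toAddMonoidHom).codRestrict S.toAddSubgroup fun x => hS.d_mem x x.2
  d_mem i x hx := M.d_mem i x hx
  d_d x := Subtype.ext (M.d_d x)
  leibniz i x a hx := Subtype.ext (M.leibniz i x a hx)

/-- The inclusion of a dg submodule. -/
def subι : M.sub S hS ⟶ M := ⟨S.subtype, fun _ _ h => h, fun _ => rfl⟩

/-- The quotient of a dg module by a dg submodule. -/
def quot : DGMod A where
  carrier := M.carrier ⧸ S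
  gr i := (M.gr i).map S.mkQ.toAddMonoidHom
  isInternal := by
    refine isInternal_of_proj _
      (fun i => QuotientAddGroup.map S.toAddSubgroup S.toAddSubgroup (M.proj i)
        fun x hx => hS.proj_mem i x hx) ?_ ?_ ?_
    · rintro i _ ⟨x, hx, rfl⟩
      exact congrArg S.mkQ (M.proj_same hx)
    · rintro i j _ ⟨x, hx, rfl⟩ h
      exact (congrArg S.mkQ (M.proj_ne hx h)).trans (map_zero _)
    · intro x
      obtain ⟨x, rfl⟩ := S.mkQ_surjective x
      obtain ⟨s, _, h2⟩ := M.exists_sum_proj x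
      refine ⟨s, fun i _ => ⟨M.proj i x, M.proj_mem i x, rfl⟩, ?_⟩
      conv_lhs => rw [h2]
      rw [map_sum]; rfl
  smul_mem := by
    rintro i j _ a ⟨x, hx, rfl⟩ ha
    exact ⟨op a • x, M.smul_mem i j x a hx ha, map_smul S.mkQ _ _⟩
  d := QuotientAddGroup.map S.toAddSubgroup S.toAddSubgroup M.d fun x hx => hS.d_mem x hx
  d_mem := by
    rintro i _ ⟨x, hx, rfl⟩
    exact ⟨M.d x, M.d_mem i x hx, rfl⟩
  d_d x := by
    obtain ⟨x, rfl⟩ := S.mkQ_surjective x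
    exact (congrArg S.mkQ (M.d_d x)).trans (map_zero _)
  leibniz := by
    rintro i _ a ⟨x, hx, rfl⟩
    exact (congrArg S.mkQ (M.leibniz i x a hx))

/-- The projection onto the quotient by a dg submodule. -/
def quotπ : M ⟶ M.quot S hS := ⟨S.mkQ, fun _ x h => ⟨x, h, rfl⟩, fun _ => rfl⟩

end SubQuot

lemma isDGSubmodule_ker {M N : DGMod A} (f : M ⟶ N) : M.IsDGSubmodule (LinearMap.ker (lin f)) where
  proj_mem i x hx := by
    rw [LinearMap.mem_ker] at hx ⊢
    rw [lin_proj, hx, map_zero]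
  d_mem x hx := by
    rw [LinearMap.mem_ker] at hx ⊢
    rw [lin_d, hx, map_zero]

lemma isDGSubmodule_range {M N : DGMod A} (f : M ⟶ N) :
    N.IsDGSubmodule (LinearMap.range (lin f)) where
  proj_mem := by
    rintro i _ ⟨x, rfl⟩
    exact ⟨M.proj i x, lin_proj f i x⟩
  d_mem := by
    rintro _ ⟨x, rfl⟩
    exact ⟨M.d x, lin_d f x⟩

/-- A morphism which is injective reflects degrees. -/
lemma mem_gr_of_injective {M N : DGMod A} (f : M ⟶ N) (hf : Function.Injective (lin f)) {i : ℤ}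
    {x : M.carrier} (h : lin f x ∈ N.gr i) : x ∈ M.gr i :=
  M.mem_gr_of_proj fun j hj => hf (by rw [lin_proj, N.proj_ne h hj.symm, map_zero])

/-- The universal property of the kernel, for an injective morphism onto the kernel. -/
noncomputable def isLimitOfExact {K M N : DGMod A} (i : K ⟶ M) (f : M ⟶ N) (w : i ≫ f = 0)
    (hi : Function.Injective (lin i)) (he : ∀ x, lin f x = 0 → ∃ y, lin i y = x) :
    IsLimit (KernelFork.ofι i w) :=
  have aux : ∀ {W : DGMod A} (k : W ⟶ M), k ≫ f = 0 → ∀ x, ∃ y, lin i y = lin k x :=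
    fun k hk x => he _ (LinearMap.congr_fun (congrArg lin hk) x)
  KernelFork.IsLimit.ofι i w
    (fun {W} k hk =>
      { toLin :=
          { toFun := fun x => (aux k hk x).choose
            map_add' := fun x y => hi (by
              rw [(aux k hk (x + y)).choose_spec, map_add, map_add, (aux k hk x).choose_spec,
                (aux k hk y).choose_spec])
            map_smul' := fun a x => hi (by
              rw [(aux k hk (a • x)).choose_spec, RingHom.id_apply, map_smul, map_smul,
                (aux k hk x).choose_spec]) }
        map_gr := fun n x hx => mem_gr_of_injective i hi (by
          change lin i (aux k hk x).choose ∈ _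
          rw [(aux k hk x).choose_spec]; exact lin_gr k hx)
        map_d := fun x => hi (by
          change lin i (aux k hk _).choose = lin i (K.d (aux k hk x).choose)
          rw [(aux k hk _).choose_spec, lin_d, lin_d, (aux k hk _).choose_spec]) })
    (fun {W} k hk => hom_ext fun x => (aux k hk x).choose_spec)
    (fun {W} k hk m hm => hom_ext fun x => hi (by
      change lin i (lin m x) = lin i (aux k hk x).choose
      rw [(aux k hk x).choose_spec, ← hm]; rfl))

/-- The universal property of the cokernel, for a surjective morphism. -/
noncomputable def isColimitOfExact {K M N : DGMod A} (f : K ⟶ M) (p : M ⟶ N) (w : f ≫ p = 0)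
    (hp : Function.Surjective (lin p)) (he : ∀ x, lin p x = 0 → ∃ y, lin f y = x) :
    IsColimit (CokernelCofork.ofπ p w) :=
  have aux : ∀ {W : DGMod A} (k : M ⟶ W), f ≫ k = 0 → ∀ x y, lin p x = lin p y →
      lin k x = lin k y := fun k hk x y hxy => by
    obtain ⟨z, hz⟩ := he (x - y) (by rw [map_sub, hxy, sub_self])
    rw [← sub_eq_zero, ← map_sub, ← hz]
    exact LinearMap.congr_fun (congrArg lin hk) z
  have hs : ∀ x, lin p (Function.surjInv hp x) = x := Function.surjInv_eq hp
  CokernelCofork.IsColimit.ofπ p w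
    (fun {W} k hk =>
      { toLin :=
          { toFun := fun x => lin k (Function.surjInv hp x)
            map_add' := fun x y => by
              rw [← map_add]; exact aux k hk _ _ (by rw [map_add, hs, hs, hs])
            map_smul' := fun a x => by
              rw [RingHom.id_apply, ← map_smul]
              exact aux k hk _ _ (by rw [map_smul, hs, hs]) }
        map_gr := fun n x hx => by
          change lin k (Function.surjInv hp x) ∈ _
          rw [aux k hk (Function.surjInv hp x) (M.proj n (Function.surjInv hp x))
            (by rw [lin_proj, hs, N.proj_same hx])]
          exact lin_gr k (M.proj_mem n _)
        map_d := fun x => by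
          change lin k (Function.surjInv hp _) = W.d (lin k _)
          rw [← lin_d]
          exact aux k hk _ _ (by rw [lin_d, hs, hs]) })
    (fun {W} k hk => hom_ext fun x => aux k hk _ _ (hs _))
    (fun {W} k hk m hm => hom_ext fun x => by
      change lin m x = lin k (Function.surjInv hp x)
      rw [← hm]
      exact congrArg (lin m) (hs x).symm)

lemma subι_comp_eq_zero {M N : DGMod A} (f : M ⟶ N) :
    M.subι _ (isDGSubmodule_ker f) ≫ f = 0 := hom_ext fun x => x.2

lemma comp_quotπ_eq_zero {M N : DGMod A} (f : M ⟶ N) :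
    f ≫ N.quotπ _ (isDGSubmodule_range f) = 0 :=
  hom_ext fun x => (Submodule.Quotient.mk_eq_zero _).2 ⟨x, rfl⟩

instance : HasKernels (DGMod A) where
  has_limit f := ⟨⟨⟨_, isLimitOfExact (subι _ _ (isDGSubmodule_ker f)) f (subι_comp_eq_zero f)
    Subtype.val_injective fun x hx => ⟨⟨x, hx⟩, rfl⟩⟩⟩⟩

instance : HasCokernels (DGMod A) where
  has_colimit f := ⟨⟨⟨_, isColimitOfExact f (quotπ _ _ (isDGSubmodule_range f))
    (comp_quotπ_eq_zero f) (Submodule.mkQ_surjective _)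
    fun _ hx => (Submodule.Quotient.mk_eq_zero _).1 hx⟩⟩⟩

lemma injective_of_mono {M N : DGMod A} (f : M ⟶ N) [Mono f] : Function.Injective (lin f) := by
  rw [injective_iff_map_eq_zero]
  intro x hx
  have h : subι _ _ (isDGSubmodule_ker f) = 0 :=
    (cancel_mono f).1 (by rw [subι_comp_eq_zero, zero_comp])
  exact LinearMap.congr_fun (congrArg lin h) ⟨x, hx⟩

lemma surjective_of_epi {M N : DGMod A} (f : M ⟶ N) [Epi f] : Function.Surjective (lin f) := by
  intro x
  have h : quotπ _ _ (isDGSubmodule_range f) = 0 :=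
    (cancel_epi f).1 (by rw [comp_quotπ_eq_zero, comp_zero])
  exact (Submodule.Quotient.mk_eq_zero _).1 (LinearMap.congr_fun (congrArg lin h) x)

/-- The direct sum of two dg modules. -/
def prod (M N : DGMod A) : DGMod A where
  carrier := M.carrier × N.carrier
  gr i := (M.gr i).prod (N.gr i)
  isInternal := by
    refine isInternal_of_proj _ (fun i => (M.proj i).prodMap (N.proj i)) ?_ ?_ ?_
    · rintro i ⟨x, y⟩ ⟨hx, hy⟩; exact Prod.ext (M.proj_same hx) (N.proj_same hy)
    · rintro i j ⟨x, y⟩ ⟨hx, hy⟩ h; exact Prod.ext (M.proj_ne hx h) (N.proj_ne hy h)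
    · rintro ⟨x, y⟩
      obtain ⟨s, h1, h2⟩ := M.exists_sum_proj x
      obtain ⟨t, h3, h4⟩ := N.exists_sum_proj y
      refine ⟨s ∪ t, fun i _ => ⟨M.proj_mem i x, N.proj_mem i y⟩, ?_⟩
      refine Prod.ext ?_ ?_
      · rw [Prod.fst_sum]; exact M.sum_proj_of_subset h1 h2 Finset.subset_union_left
      · rw [Prod.snd_sum]; exact N.sum_proj_of_subset h3 h4 Finset.subset_union_right
  smul_mem i j x a hx ha := ⟨M.smul_mem i j x.1 a hx.1 ha, N.smul_mem i j x.2 a hx.2 ha⟩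
  d := M.d.prodMap N.d
  d_mem i x hx := ⟨M.d_mem i x.1 hx.1, N.d_mem i x.2 hx.2⟩
  d_d x := Prod.ext (M.d_d x.1) (N.d_d x.2)
  leibniz i x a hx := Prod.ext (M.leibniz i x.1 a hx.1) (N.leibniz i x.2 a hx.2)

instance : HasBinaryProducts (DGMod A) := by
  refine @hasBinaryProducts_of_hasLimit_pair _ _ fun {M N} => ⟨⟨⟨BinaryFan.mk (P := prod M N)
    ⟨LinearMap.fst _ _ _, fun _ _ h => h.1, fun _ => rfl⟩
    ⟨LinearMap.snd _ _ _, fun _ _ h => h.2, fun _ => rfl⟩,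
    BinaryFan.isLimitMk
      (fun s => ⟨(lin s.fst).prod (lin s.snd), fun _ _ h => ⟨lin_gr s.fst h, lin_gr s.snd h⟩,
        fun x => Prod.ext (lin_d s.fst x) (lin_d s.snd x)⟩)
      (fun s => rfl) (fun s => rfl) ?_⟩⟩⟩
  intro s m h1 h2
  exact hom_ext fun x => Prod.ext (LinearMap.congr_fun (congrArg lin h1) x)
    (LinearMap.congr_fun (congrArg lin h2) x)

/-- The zero dg module. -/
def zeroObj (A : DGRing.{u}) : DGMod A where
  carrier := PUnit
  gr _ := ⊥
  isInternal := isInternal_of_proj _ 0 (fun _ _ _ => rfl) (fun _ _ _ _ _ => rfl)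
    fun _ => ⟨∅, by simp, rfl⟩
  smul_mem _ _ _ _ _ _ := rfl
  d := 0
  d_mem _ _ _ := rfl
  d_d _ := rfl
  leibniz _ _ _ _ := rfl

instance : HasZeroObject (DGMod A) :=
  ⟨zeroObj A, by rw [IsZero.iff_id_eq_zero]; exact hom_ext fun _ => rfl⟩

instance : HasFiniteProducts (DGMod A) :=
  hasFiniteProducts_of_has_binary_and_terminal

/-- The category of dg modules is abelian. -/
noncomputable instance : Abelian (DGMod A) where
  normalMonoOfMono f _ := ⟨
    { Z := _
      g := quotπ _ _ (isDGSubmodule_range f)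
      w := comp_quotπ_eq_zero f
      isLimit := isLimitOfExact _ _ _ (injective_of_mono f)
        fun _ hx => (Submodule.Quotient.mk_eq_zero _).1 hx }⟩
  normalEpiOfEpi f _ := ⟨
    { W := _
      g := subι _ _ (isDGSubmodule_ker f)
      w := subι_comp_eq_zero f
      isColimit := isColimitOfExact _ _ _ (surjective_of_epi f)
        fun x hx => ⟨⟨x, hx⟩, rfl⟩ }⟩

/-! ### Shifts -/

/-- The shift `M[n]`: `M[n]^i = M^(n+i)`, the differential is multiplied by `(-1)^n` and the
right action is unchanged. -/
def shiftObj (n : ℤ) (M : DGMod A) : DGMod A where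
  carrier := M.carrier
  gr i := M.gr (n + i)
  isInternal := by
    refine isInternal_of_proj _ (fun i => M.proj (n + i)) (fun i x hx => M.proj_same hx)
      (fun i j x hx h => M.proj_ne hx (by simpa using h)) fun x => ?_
    obtain ⟨s, h1, h2⟩ := M.exists_sum_proj x
    refine ⟨s.map (Equiv.addLeft (-n)).toEmbedding, fun i _ => M.proj_mem _ _, ?_⟩
    rw [Finset.sum_map]
    simpa using h2
  smul_mem i j x a hx ha := by rw [← add_assoc]; exact M.smul_mem _ j x a hx ha
  d := n.negOnePow • M.d
  d_mem i x hx := by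
    rw [← add_assoc]
    rcases Int.units_eq_one_or n.negOnePow with h | h
    · simpa [h] using M.d_mem _ x hx
    · simpa [h] using M.d_mem _ x hx
  d_d x := by
    rcases Int.units_eq_one_or n.negOnePow with h | h <;> simp [h, M.d_d]
  leibniz i x a hx := by
    have := M.leibniz _ x a hx
    rw [Int.negOnePow_add] at this
    rcases Int.units_eq_one_or n.negOnePow with h | h
    · simpa [h] using this
    · rw [h, neg_one_mul, Units.neg_smul] at this
      simp [h, this, add_comm]

lemma shiftObj_d (n : ℤ) (M : DGMod A) (x : M.carrier) :
    (shiftObj n M).d x = n.negOnePow • M.d x := rfl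

lemma lin_units_smul {M N : DGMod A} (f : M ⟶ N) (ε : ℤˣ) (x : M.carrier) :
    lin f (ε • x) = ε • lin f x := by
  rcases Int.units_eq_one_or ε with h | h <;> simp [h]

/-- The shift functor. -/
def shiftFun (n : ℤ) : DGMod A ⥤ DGMod A where
  obj M := shiftObj n M
  map {M N} f := ⟨(lin f : M.carrier →ₗ[A.carrierᵐᵒᵖ] N.carrier), fun _ _ h => lin_gr f h,
    fun x => (lin_units_smul f n.negOnePow (M.d x)).trans
      (congrArg (n.negOnePow • ·) (lin_d f x))⟩

/-- An isomorphism of dg modules from an isomorphism of `A`-modules. -/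
def isoMk {M N : DGMod A} (e : M.carrier ≃ₗ[A.carrierᵐᵒᵖ] N.carrier)
    (h : ∀ i x, x ∈ M.gr i ↔ e x ∈ N.gr i) (hd : ∀ x, e (M.d x) = N.d (e x)) : M ≅ N where
  hom := ⟨e, fun i x => (h i x).1, hd⟩
  inv := ⟨e.symm, fun i x hx => (h i _).2 (by simpa using hx), fun x => e.injective (by simp [hd])⟩
  hom_inv_id := hom_ext e.symm_apply_apply
  inv_hom_id := hom_ext e.apply_symm_apply

/-- The isomorphism `M[0] ≅ M`, which is the identity on elements. -/
def shiftZeroIso (M : DGMod A) : shiftObj 0 M ≅ M :=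
  isoMk (LinearEquiv.refl A.carrierᵐᵒᵖ M.carrier)
    (fun i x => by change x ∈ M.gr (0 + i) ↔ x ∈ M.gr i; rw [zero_add])
    (fun x => by change (0 : ℤ).negOnePow • M.d x = M.d x; simp)

/-- The isomorphism `M[n + m] ≅ M[n][m]`, which is the identity on elements. -/
def shiftAddIso (n m : ℤ) (M : DGMod A) : shiftObj (n + m) M ≅ shiftObj m (shiftObj n M) :=
  isoMk (LinearEquiv.refl A.carrierᵐᵒᵖ M.carrier)
    (fun i x => by change x ∈ M.gr (n + m + i) ↔ x ∈ M.gr (n + (m + i)); rw [add_assoc])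
    (fun x => by
      change (n + m).negOnePow • M.d x = m.negOnePow • n.negOnePow • M.d x
      rw [smul_smul, Int.negOnePow_add, mul_comm])

lemma lin_eqToHom_shift {n n' : ℤ} (h : n = n') (M : DGMod A) (h' : shiftObj n M = shiftObj n' M)
    (x : M.carrier) : lin (eqToHom h') x = x := by
  subst h; rfl

/-- The shift functors define an action of `ℤ`. -/
noncomputable instance : HasShift (DGMod A) ℤ :=
  hasShiftMk (DGMod A) ℤ
    { F := shiftFun
      zero := NatIso.ofComponents shiftZeroIso fun _ => rfl
      add := fun n m => NatIso.ofComponents (shiftAddIso n m) fun _ => rfl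
      assoc_hom_app := fun a b c M => hom_ext fun x =>
        (lin_eqToHom_shift (add_assoc a b c) M _ x).symm
      zero_add_hom_app := fun n M => hom_ext fun x =>
        (lin_eqToHom_shift (zero_add n) M _ x).symm
      add_zero_hom_app := fun n M => hom_ext fun x =>
        (lin_eqToHom_shift (add_zero n) M _ x).symm }

/-- The `A^0`-module underlying a dg module: forget the differential and the grading. -/
noncomputable def toDegZeroModule (M : DGMod A) : ModuleCat.{u} A.degZeroᵐᵒᵖ :=
  (ModuleCat.restrictScalars (RingHom.op A.degZeroInclusion)).obj
    (ModuleCat.of A.carrierᵐᵒᵖ M.carrier)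

end DGMod

/-! ### The dg module `D(M)` -/

namespace DGRing

variable (A : DGRing.{u})

/-- The component of degree `0` of an element of `A`. -/
def degZeroPart : A.carrier →+ A.degZero where
  toFun a := ⟨decompose A.gr a 0, (decompose A.gr a 0).2⟩
  map_zero' := Subtype.ext (by simp)
  map_add' _ _ := Subtype.ext (by simp)

lemma degZeroPart_of_mem {a : A.carrier} (ha : a ∈ A.gr 0) : (A.degZeroPart a : A.carrier) = a :=
  decompose_of_mem_same A.gr ha

lemma degZeroPart_of_mem_ne {a : A.carrier} {i : ℤ} (ha : a ∈ A.gr i) (hi : i ≠ 0) :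
    A.degZeroPart a = 0 :=
  Subtype.ext (decompose_of_mem_ne A.gr ha hi)

@[elab_as_elim]
lemma induction_gr {p : A.carrier → Prop} (x : A.carrier) (h0 : p 0)
    (hg : ∀ i, ∀ y ∈ A.gr i, p y) (ha : ∀ y z, p y → p z → p (y + z)) : p x :=
  Decomposition.inductionOn A.gr h0 (fun {i} y => hg i y y.2) ha x

variable {A}

lemma IsNonpositive.eq_zero (hA : A.IsNonpositive) {i : ℤ} (hi : 0 < i) {a : A.carrier}
    (ha : a ∈ A.gr i) : a = 0 := by
  rw [hA i hi] at ha; exact ha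

lemma IsNonpositive.degZeroPart_mul (hA : A.IsNonpositive) (a b : A.carrier) :
    A.degZeroPart (a * b) = A.degZeroPart a * A.degZeroPart b := by
  induction a using A.induction_gr with
  | h0 => simp
  | ha y z hy hz => simp [add_mul, hy, hz]
  | hg i a ha =>
    induction b using A.induction_gr with
    | h0 => simp
    | ha y z hy hz => simp [mul_add, hy, hz]
    | hg j b hb =>
      have hab : a * b ∈ A.gr (i + j) := SetLike.mul_mem_graded ha hb
      rcases lt_trichotomy i 0 with hi | hi | hi
      · rw [A.degZeroPart_of_mem_ne ha hi.ne, zero_mul]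
        rcases le_or_gt j 0 with hj | hj
        · exact A.degZeroPart_of_mem_ne hab (by omega)
        · rw [hA.eq_zero hj hb, mul_zero, map_zero]
      · subst hi
        by_cases hj : j = 0
        · subst hj
          apply Subtype.ext
          change _ = (A.degZeroPart a : A.carrier) * (A.degZeroPart b : A.carrier)
          rw [A.degZeroPart_of_mem ha, A.degZeroPart_of_mem hb, A.degZeroPart_of_mem (by simpa using hab)]
        · rw [A.degZeroPart_of_mem_ne hb hj, mul_zero]
          exact A.degZeroPart_of_mem_ne hab (by omega)
      · rw [hA.eq_zero hi ha]; simp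

lemma degZeroPart_one : A.degZeroPart 1 = 1 :=
  Subtype.ext (A.degZeroPart_of_mem (SetLike.one_mem_graded A.gr))

lemma IsNonpositive.d_eq_zero (hA : A.IsNonpositive) {a : A.carrier} (ha : a ∈ A.gr 0) :
    A.d a = 0 :=
  hA.eq_zero (i := 0 + 1) (by norm_num) (A.d_mem 0 a ha)

lemma IsNonpositive.degZeroPart_d_mul (hA : A.IsNonpositive) (a b : A.carrier) :
    A.degZeroPart (A.d (a * b)) =
      A.degZeroPart (A.d a) * A.degZeroPart b + A.degZeroPart a * A.degZeroPart (A.d b) := by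
  induction a using A.induction_gr with
  | h0 => simp
  | ha y z hy hz => simp only [add_mul, map_add, hy, hz]; abel
  | hg i a ha =>
    rw [A.leibniz i a b ha, map_add, hA.degZeroPart_mul]
    congr 1
    by_cases hi : i = 0
    · subst hi; simp [hA.degZeroPart_mul]
    · rw [A.degZeroPart_of_mem_ne ha hi, zero_mul]
      rcases Int.units_eq_one_or i.negOnePow with h | h <;>
        simp [h, hA.degZeroPart_mul, A.degZeroPart_of_mem_ne ha hi]

end DGRing

section Disk

variable {A : DGRing.{u}} (hA : A.IsNonpositive) (M : ModuleCat.{u} A.degZeroᵐᵒᵖ)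

/-- The right action of `A` on `M ⊕ M`: the pair `(x, y)` has the component `x` in degree `-1` and
`y` in degree `0`. The element `a` acts by `(x, y) a = (x a₀ + y d(a₋₁), y a₀)`. Note that
`d(a₋₁)` is the component of degree `0` of `d a`. -/
@[reducible]
def diskModule : Module A.carrierᵐᵒᵖ (M × M) where
  smul a p := (op (A.degZeroPart a.unop) • p.1 + op (A.degZeroPart (A.d a.unop)) • p.2,
    op (A.degZeroPart a.unop) • p.2)
  one_smul p := by
    have h1 : A.d 1 = 0 := hA.d_eq_zero (SetLike.one_mem_graded A.gr)
    refine Prod.ext ?_ ?_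
    · change op (A.degZeroPart 1) • p.1 + op (A.degZeroPart (A.d 1)) • p.2 = p.1
      rw [h1, DGRing.degZeroPart_one]; simp
    · change op (A.degZeroPart 1) • p.2 = p.2
      rw [DGRing.degZeroPart_one]; simp
  mul_smul a b p := by
    refine Prod.ext ?_ ?_
    · change op (A.degZeroPart (b.unop * a.unop)) • p.1 +
        op (A.degZeroPart (A.d (b.unop * a.unop))) • p.2 =
        op (A.degZeroPart a.unop) • (op (A.degZeroPart b.unop) • p.1 +
          op (A.degZeroPart (A.d b.unop)) • p.2) +
        op (A.degZeroPart (A.d a.unop)) • op (A.degZeroPart b.unop) • p.2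
      rw [hA.degZeroPart_mul, hA.degZeroPart_d_mul, MulOpposite.op_mul, MulOpposite.op_add, MulOpposite.op_mul, MulOpposite.op_mul, add_smul,
        mul_smul, mul_smul, mul_smul, smul_add, add_assoc]
    · change op (A.degZeroPart (b.unop * a.unop)) • p.2 =
        op (A.degZeroPart a.unop) • op (A.degZeroPart b.unop) • p.2
      rw [hA.degZeroPart_mul, MulOpposite.op_mul, mul_smul]
  smul_zero a := by
    refine Prod.ext ?_ ?_
    · change op (A.degZeroPart a.unop) • (0 : M) + op (A.degZeroPart (A.d a.unop)) • (0 : M) = 0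
      simp
    · exact smul_zero _
  smul_add a p q := by
    refine Prod.ext ?_ ?_
    · change op (A.degZeroPart a.unop) • (p.1 + q.1) +
        op (A.degZeroPart (A.d a.unop)) • (p.2 + q.2) =
        (op (A.degZeroPart a.unop) • p.1 + op (A.degZeroPart (A.d a.unop)) • p.2) +
        (op (A.degZeroPart a.unop) • q.1 + op (A.degZeroPart (A.d a.unop)) • q.2)
      rw [smul_add, smul_add]; abel
    · exact smul_add _ _ _
  add_smul a b p := by
    refine Prod.ext ?_ ?_
    · change op (A.degZeroPart (a.unop + b.unop)) • p.1 +
        op (A.degZeroPart (A.d (a.unop + b.unop))) • p.2 =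
        (op (A.degZeroPart a.unop) • p.1 + op (A.degZeroPart (A.d a.unop)) • p.2) +
        (op (A.degZeroPart b.unop) • p.1 + op (A.degZeroPart (A.d b.unop)) • p.2)
      rw [map_add, map_add, map_add, MulOpposite.op_add, MulOpposite.op_add, add_smul, add_smul]; abel
    · change op (A.degZeroPart (a.unop + b.unop)) • p.2 = _
      rw [map_add, MulOpposite.op_add, add_smul]; rfl
  zero_smul p := by
    refine Prod.ext ?_ ?_
    · change op (A.degZeroPart 0) • p.1 + op (A.degZeroPart (A.d 0)) • p.2 = 0
      simp
    · change op (A.degZeroPart 0) • p.2 = 0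
      simp

lemma diskModule_smul (a : A.carrier) (p : M × M) :
    letI := diskModule hA M
    op a • p = (op (A.degZeroPart a) • p.1 + op (A.degZeroPart (A.d a)) • p.2,
      op (A.degZeroPart a) • p.2) := rfl

/-- The grading of `M ⊕ M` with the first summand in degree `-1` and the second in degree `0`. -/
def diskGr (i : ℤ) : AddSubgroup (M × M) where
  carrier := {p | (i ≠ -1 → p.1 = 0) ∧ (i ≠ 0 → p.2 = 0)}
  zero_mem' := ⟨fun _ => rfl, fun _ => rfl⟩
  add_mem' {p q} hp hq := ⟨fun h => by simp [hp.1 h, hq.1 h], fun h => by simp [hp.2 h, hq.2 h]⟩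
  neg_mem' {p} hp := ⟨fun h => by simp [hp.1 h], fun h => by simp [hp.2 h]⟩

/-- The dg module `D(M) = (M → M)` concentrated in degrees `-1` and `0`, with the identity as
differential, for an `A^0`-module `M`. -/
def DGMod.D : DGMod A where
  carrier := M × M
  module := diskModule hA M
  gr := diskGr M
  isInternal := by
    refine isInternal_of_proj _ (fun i => if i = -1 then (AddMonoidHom.inl M M).comp
      (AddMonoidHom.fst M M) else if i = 0 then (AddMonoidHom.inr M M).comp
      (AddMonoidHom.snd M M) else 0) ?_ ?_ ?_
    · rintro i ⟨x, y⟩ ⟨hx, hy⟩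
      by_cases h : i = -1
      · subst h; simp_all
      · by_cases h' : i = 0
        · subst h'; simp_all
        · obtain rfl : x = 0 := hx h
          obtain rfl : y = 0 := hy h'
          simp only [h, h', if_false]; rfl
    · rintro i j ⟨x, y⟩ ⟨hx, hy⟩ hij
      by_cases h : j = -1
      · subst h; simp_all
      · by_cases h' : j = 0
        · subst h'; simp_all
        · simp_all
    · rintro ⟨x, y⟩
      refine ⟨{-1, 0}, ?_, ?_⟩
      · intro i hi
        simp only [Finset.mem_insert, Finset.mem_singleton] at hi
        rcases hi with rfl | rfl <;> simp [diskGr, ← AddSubgroup.mem_carrier]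
      · simp
  smul_mem := by
    rintro i j ⟨x, y⟩ a ⟨hx, hy⟩ ha
    rw [diskModule_smul]
    have key : j ≠ 0 → A.degZeroPart a = 0 := A.degZeroPart_of_mem_ne ha
    have key' : j ≠ -1 → A.degZeroPart (A.d a) = 0 := fun h =>
      A.degZeroPart_of_mem_ne (A.d_mem j a ha) (by omega)
    refine ⟨fun h => ?_, fun h => ?_⟩
    · have h1 : op (A.degZeroPart a) • x = 0 := by
        by_cases hj : j = 0
        · rw [show x = 0 from hx (by omega), smul_zero]
        · rw [key hj]; simp
      have h2 : op (A.degZeroPart (A.d a)) • y = 0 := by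
        by_cases hj : j = -1
        · rw [show y = 0 from hy (by omega), smul_zero]
        · rw [key' hj]; simp
      simp [h1, h2]
    · change op (A.degZeroPart a) • y = 0
      by_cases hj : j = 0
      · rw [show y = 0 from hy (by omega), smul_zero]
      · rw [key hj]; simp
  d := (AddMonoidHom.inr M M).comp (AddMonoidHom.fst M M)
  d_mem := by
    rintro i ⟨x, y⟩ ⟨hx, hy⟩
    exact ⟨fun _ => rfl, fun h => hx (by omega)⟩
  d_d x := rfl
  leibniz := by
    rintro i ⟨x, y⟩ a ⟨hx, hy⟩
    refine Prod.ext ?_ ?_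
    · change (0 : M) = op (A.degZeroPart a) • (0 : M) + op (A.degZeroPart (A.d a)) • x +
        i.negOnePow • (op (A.degZeroPart (A.d a)) • x + op (A.degZeroPart (A.d (A.d a))) • y)
      rw [A.d_d, map_zero, MulOpposite.op_zero, zero_smul, smul_zero, add_zero, zero_add]
      by_cases hi : i = -1
      · simp [hi]
      · rw [show x = 0 from hx hi]; simp
    · change op (A.degZeroPart a) • x + op (A.degZeroPart (A.d a)) • y =
        op (A.degZeroPart a) • x + i.negOnePow • (op (A.degZeroPart (A.d a)) • y)
      by_cases hi : i = 0
      · simp [hi]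
      · rw [show y = 0 from hy hi]; simp

end Disk

end DG

/-! Everything is read off from annihilators of single elements. Two `A^0`-modules share a nonzero
submodule iff they contain nonzero elements with the same annihilator, and the atom of `H` lies in
the support of `M` iff the annihilator of some element of `M` is contained in that of a nonzero
element of `H`. In `dgMod A` homogeneous cycles take over this role: every nonzero dg module
contains a nonzero one (a homogeneous `x`, or else `dx`), and a cycle `z` of degree `k` is a
morphism `A[-k] ⟶ M` with image `zA`.

The nonzero homogeneous cycles of `D(H)[n]` are the `(0, h)` with `h ≠ 0`, all in degree `-n`, and
`(0, h) a = (h d(a₋₁), h a₀)`. So the annihilator of `(0, h)` in `A` and that of `h` in `A^0`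
determine each other. Hence `D(H)[n]` is monoform when `H` is (`isMonoform_disk`), and its atom
determines `n` and the atom of `H` (`haveCommonNonzeroSubobject_disk_iff`).

Every atom arises in this way (`exists_disk_of_isMonoform`). In a monoform `X` take a nonzero cycle
and, among the nonzero homogeneous cycles of the dg submodule it generates, one of lowest degree,
say `z` of degree `k`; it exists because `A` is bounded. As `A` is non-positive, all nonzero
homogeneous cycles of `zA` then have degree `k`. Since `d(zb) = ± z d(b)`, this forces `z A^i = 0`
for `i ≠ 0, -1`, and for `b` in `A^(-1)` it makes `zb = 0` equivalent to `z d(b) = 0`. So `z` has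
the annihilator of the cycle `(0, z)` of `D(zA^0)[-k]`, and `zA` embeds into both `X` and this disk.
That `zA^0` is monoform is inherited from `zA`.

For supports, `d` is `A^0`-linear because `A^1 = 0`. An element of `M` whose annihilator in `A^0`
lies in that of some `h ≠ 0` can therefore be replaced by a homogeneous cycle, if `h` is replaced by
a nonzero multiple (`exists_cycle_of_annihilator`). This identifies the supports, and the
homeomorphism follows since supports form bases. -/

section Atoms

/-! ### Subquotients, atom supports and the topology in an abelian category. -/

variable {C : Type u} [Category.{v} C] [Abelian C]

/-- For `K ≤ L ≤ H`, an element of `L` that vanishes in `H / K` already comes from `K`. The chase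
uses elements up to refinement along epimorphisms. -/
lemma mono_cokernelMap_of_mono {K L H : C} (k : K ⟶ L) (i : L ⟶ H) [Mono i] :
    Mono (cokernel.desc k (i ≫ cokernel.π (k ≫ i)) (by
      rw [← Category.assoc, cokernel.condition])) := by
  refine Preadditive.mono_of_cancel_zero _ fun {P} g hg => ?_
  obtain ⟨P', e, _, l, hl⟩ := surjective_up_to_refinements_of_epi (cokernel.π k) g
  have h1 : (l ≫ i) ≫ cokernel.π (k ≫ i) = 0 := by
    have : l ≫ cokernel.π k ≫ cokernel.desc k (i ≫ cokernel.π (k ≫ i)) (by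
      rw [← Category.assoc, cokernel.condition]) = 0 := by
      rw [← Category.assoc, ← hl, Category.assoc, hg, comp_zero]
    simpa using this
  obtain ⟨P'', e', _, x, hx⟩ := (ShortComplex.exact_cokernel (k ≫ i)).exact_up_to_refinements _ h1
  have h2 : e' ≫ l = x ≫ k := by
    rw [← cancel_mono i, Category.assoc, Category.assoc]; exact hx
  have h3 : e' ≫ e ≫ g = 0 := by
    rw [hl, ← Category.assoc, h2, Category.assoc, cokernel.condition, comp_zero]
  have h4 : e ≫ g = 0 := (cancel_epi e').1 (by rw [h3, comp_zero])
  exact (cancel_epi e).1 (by rw [h4, comp_zero])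

/-- A nonzero subobject of a monoform object is monoform. -/
lemma IsMonoform.of_mono {L H : C} (hH : IsMonoform H) (i : L ⟶ H) [Mono i] (hL : ¬ IsZero L) :
    IsMonoform L where
  not_isZero := hL
  not_common K k _ hK := by
    rintro ⟨Z, a, b, _, _, hZ⟩
    have := mono_cokernelMap_of_mono k i
    exact hH.not_common K (k ≫ i) hK ⟨Z, a ≫ i, b ≫ cokernel.desc k (i ≫ cokernel.π (k ≫ i)) _,
      mono_comp _ _, mono_comp _ _, hZ⟩

lemma IsSubquotient.of_mono {Z H M : C} (h : IsSubquotient H M) (j : Z ⟶ H) [Mono j] :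
    IsSubquotient Z M := by
  obtain ⟨L, i, p, _, _⟩ := h
  exact ⟨pullback p j, pullback.fst p j ≫ i, pullback.snd p j, inferInstance, inferInstance⟩

lemma IsSubquotient.trans {X Y Z : C} (h : IsSubquotient X Y) (h' : IsSubquotient Y Z) :
    IsSubquotient X Z := by
  obtain ⟨L, i, p, _, _⟩ := h
  obtain ⟨L', i', p', _, _⟩ := h'.of_mono i
  exact ⟨L', i', p' ≫ p, inferInstance, epi_comp _ _⟩

lemma AtomSpectrum.mk_eq_mk_iff {H K : C} {hH : IsMonoform H} {hK : IsMonoform K} :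
    AtomSpectrum.mk H hH = AtomSpectrum.mk K hK ↔ HaveCommonNonzeroSubobject H K :=
  Quotient.eq (r := atomSetoid)

lemma AtomSpectrum.exists_eq_mk (α : AtomSpectrum C) :
    ∃ (H : C) (hH : IsMonoform H), α = AtomSpectrum.mk H hH := by
  obtain ⟨⟨H, hH⟩, rfl⟩ := Quotient.exists_rep α
  exact ⟨H, hH, rfl⟩

/-- A nonzero subobject of `H` represents the same atom, so the representative `H` can stay fixed
when supports are tested. -/
lemma mk_mem_atomSupp_iff {H M : C} {hH : IsMonoform H} :
    AtomSpectrum.mk H hH ∈ atomSupp M ↔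
      ∃ (Z : C) (i : Z ⟶ H), Mono i ∧ ¬ IsZero Z ∧ IsSubquotient Z M := by
  constructor
  · rintro ⟨K, hK, h, hM⟩
    obtain ⟨Z, i, j, _, _, hZ⟩ := AtomSpectrum.mk_eq_mk_iff.1 h
    exact ⟨Z, i, inferInstance, hZ, hM.of_mono j⟩
  · rintro ⟨Z, i, _, hZ, hM⟩
    exact ⟨Z, hH.of_mono i hZ, AtomSpectrum.mk_eq_mk_iff.2
      ⟨Z, i, 𝟙 Z, inferInstance, inferInstance, hZ⟩, hM⟩

lemma mk_mem_atomSupp_self {H : C} (hH : IsMonoform H) : AtomSpectrum.mk H hH ∈ atomSupp H :=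
  ⟨H, hH, rfl, H, 𝟙 H, 𝟙 H, inferInstance, inferInstance⟩

lemma atomSupp_subset_of_isSubquotient {X Y : C} (h : IsSubquotient X Y) :
    atomSupp X ⊆ atomSupp Y := by
  rintro _ ⟨K, hK, rfl, hX⟩
  exact ⟨K, hK, rfl, hX.trans h⟩

lemma isOpen_atomSupp (M : C) : IsOpen (atomSupp M) :=
  TopologicalSpace.isOpen_generateFrom_of_mem ⟨M, rfl⟩

/-- The atom supports form a basis of the topology. -/
lemma exists_atomSupp_subset {V : Set (AtomSpectrum C)} (hV : IsOpen V) {α : AtomSpectrum C}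
    (hα : α ∈ V) : ∃ X : C, α ∈ atomSupp X ∧ atomSupp X ⊆ V := by
  induction hV with
  | basic s hs =>
    obtain ⟨M, rfl⟩ := hs
    exact ⟨M, hα, le_rfl⟩
  | univ =>
    obtain ⟨H, hH, rfl⟩ := α.exists_eq_mk
    exact ⟨H, mk_mem_atomSupp_self hH, Set.subset_univ _⟩
  | inter s t _ _ hs ht =>
    obtain ⟨X, hX, hXs⟩ := hs hα.1
    obtain ⟨Y, hY, hYt⟩ := ht hα.2
    -- Represent the atom by a subquotient `H` of `X`. A nonzero subobject of `H` that is also a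
    -- subquotient of `Y` has its support inside both.
    obtain ⟨H, hH, rfl, hHX⟩ := hX
    obtain ⟨Z, i, _, hZ, hZY⟩ := mk_mem_atomSupp_iff.1 hY
    refine ⟨Z, mk_mem_atomSupp_iff.2
      ⟨Z, i, inferInstance, hZ, Z, 𝟙 Z, 𝟙 Z, inferInstance, inferInstance⟩, fun β hβ =>
      ⟨hXs (atomSupp_subset_of_isSubquotient (hHX.of_mono i) hβ),
        hYt (atomSupp_subset_of_isSubquotient hZY hβ)⟩⟩
  | sUnion S _ ih =>
    obtain ⟨s, hs, hαs⟩ := hα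
    obtain ⟨X, hX, hXs⟩ := ih s hs hαs
    exact ⟨X, hX, hXs.trans (Set.subset_sUnion_of_mem hs)⟩

/-- If `f : P ⟶ X` and `g : P ⟶ Y` satisfy `ker f ≤ ker g` and `g ≠ 0`, then `Y` has a nonzero
subobject which is a subquotient of `X`. -/
lemma exists_mono_isSubquotient {P X Y : C} (f : P ⟶ X) (g : P ⟶ Y) (hg : g ≠ 0)
    (h : kernel.ι f ≫ g = 0) :
    ∃ (Z : C) (i : Z ⟶ Y), Mono i ∧ ¬ IsZero Z ∧ IsSubquotient Z X := by
  let k : Abelian.coimage f ⟶ Y := cokernel.desc _ g h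
  refine ⟨Abelian.image k, Abelian.image.ι k, inferInstance, fun hZ => hg ?_, Abelian.coimage f,
    Abelian.factorThruCoimage f, Abelian.factorThruImage k, inferInstance, inferInstance⟩
  have hk : k = 0 := by
    rw [← Abelian.image.fac k, hZ.eq_of_src (Abelian.image.ι k) 0, comp_zero]
  rw [← cokernel.π_desc (kernel.ι f) g h]
  change _ ≫ k = 0
  rw [hk, comp_zero]

/-- Equal kernels give isomorphic coimages, and the coimage of `f` embeds into `X` and that of `g`
into `Y`. -/
lemma haveCommonNonzeroSubobject_of_kernel {P X Y : C} (f : P ⟶ X) (g : P ⟶ Y) (hf : f ≠ 0)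
    (h : kernel.ι f ≫ g = 0) (h' : kernel.ι g ≫ f = 0) : HaveCommonNonzeroSubobject X Y := by
  have h₁ : kernel.ι f ≫ Abelian.coimage.π g = 0 := by
    rw [← cancel_mono (Abelian.factorThruCoimage g), Category.assoc, Abelian.coimage.fac, h,
      zero_comp]
  have h₂ : kernel.ι g ≫ Abelian.coimage.π f = 0 := by
    rw [← cancel_mono (Abelian.factorThruCoimage f), Category.assoc, Abelian.coimage.fac, h',
      zero_comp]
  let c : Abelian.coimage f ⟶ Abelian.coimage g := cokernel.desc _ (Abelian.coimage.π g) h₁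
  let c' : Abelian.coimage g ⟶ Abelian.coimage f := cokernel.desc _ (Abelian.coimage.π f) h₂
  have hc : c ≫ c' = 𝟙 _ := by
    rw [← cancel_epi (Abelian.coimage.π f)]
    simp [c, c']
  have : Mono c := mono_of_mono_fac hc
  refine ⟨Abelian.coimage f, Abelian.factorThruCoimage f, c ≫ Abelian.factorThruCoimage g,
    inferInstance, mono_comp _ _, fun hZ => hf ?_⟩
  rw [← Abelian.coimage.fac f, hZ.eq_of_src (Abelian.factorThruCoimage f) 0, comp_zero]

end Atoms

/-! ### Atoms of a module category in terms of annihilators of elements. -/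

section Modules

variable {R : Type u} [Ring R]

lemma ModuleCat.exists_ne_zero_of_not_isZero {M : ModuleCat.{u} R} (h : ¬ IsZero M) :
    ∃ x : M, x ≠ 0 := by
  by_contra! h'
  exact h (ModuleCat.isZero_of_iff_subsingleton.2 ⟨fun x y => by rw [h' x, h' y]⟩)

lemma ModuleCat.not_isZero_of_ne_zero {M : ModuleCat.{u} R} {x : M} (h : x ≠ 0) :
    ¬ IsZero M := fun h' =>
  have := ModuleCat.isZero_of_iff_subsingleton.1 h'
  h (Subsingleton.elim _ _)

/-- The morphism from the free module of rank one which sends `1` to `x`. -/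
def ModuleCat.ofElement {M : ModuleCat.{u} R} (x : M) : ModuleCat.of R R ⟶ M :=
  ModuleCat.ofHom (LinearMap.toSpanSingleton R M x)

lemma ModuleCat.ofElement_apply {M : ModuleCat.{u} R} (x : M) (a : R) :
    (ModuleCat.ofElement x).hom a = a • x := rfl

lemma ModuleCat.ofElement_ne_zero {M : ModuleCat.{u} R} {x : M} (hx : x ≠ 0) :
    ModuleCat.ofElement x ≠ 0 := fun h => hx (by
  have := congrArg (fun f => f.hom (1 : R)) h
  rw [ModuleCat.ofElement_apply, one_smul] at this
  exact this)

lemma ModuleCat.kernel_ι_ofElement {M N : ModuleCat.{u} R} {x : M} {y : N}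
    (h : ∀ a : R, a • x = 0 → a • y = 0) :
    kernel.ι (ModuleCat.ofElement x) ≫ ModuleCat.ofElement y = 0 := by
  ext t
  have := congrArg (fun f => f.hom t) (kernel.condition (ModuleCat.ofElement x))
  exact h _ this

lemma ModuleCat.injective_of_mono {M N : ModuleCat.{u} R} (f : M ⟶ N) [Mono f] :
    Function.Injective f.hom := (ModuleCat.mono_iff_injective f).1 inferInstance

/-- A nonzero submodule contains a nonzero cyclic one, and a cyclic module is determined by the
annihilator of its generator. -/
lemma ModuleCat.haveCommonNonzeroSubobject_iff {M N : ModuleCat.{u} R} :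
    HaveCommonNonzeroSubobject M N ↔
      ∃ (x : M) (y : N), x ≠ 0 ∧ ∀ a : R, a • x = 0 ↔ a • y = 0 := by
  constructor
  · rintro ⟨Z, i, j, _, _, hZ⟩
    obtain ⟨z, hz⟩ := ModuleCat.exists_ne_zero_of_not_isZero hZ
    have hi := ModuleCat.injective_of_mono i
    have hj := ModuleCat.injective_of_mono j
    refine ⟨i.hom z, j.hom z, (map_ne_zero_iff _ hi).2 hz, fun a => ?_⟩
    rw [← map_smul, ← map_smul, map_eq_zero_iff _ hi, map_eq_zero_iff _ hj]
  · rintro ⟨x, y, hx, h⟩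
    exact haveCommonNonzeroSubobject_of_kernel _ _ (ModuleCat.ofElement_ne_zero hx)
      (ModuleCat.kernel_ι_ofElement fun a => (h a).1)
      (ModuleCat.kernel_ι_ofElement fun a => (h a).2)

/-- An inclusion of annihilators is a surjection from the cyclic module on `s` to the one on `h`,
which makes the latter a subquotient of `M`. -/
lemma ModuleCat.mk_mem_atomSupp_iff {H M : ModuleCat.{u} R} {hH : IsMonoform H} :
    AtomSpectrum.mk H hH ∈ atomSupp M ↔
      ∃ (s : M) (h : H), h ≠ 0 ∧ ∀ a : R, a • s = 0 → a • h = 0 := by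
  rw [_root_.mk_mem_atomSupp_iff]
  constructor
  · rintro ⟨Z, i, _, hZ, L, j, p, _, _⟩
    obtain ⟨z, hz⟩ := ModuleCat.exists_ne_zero_of_not_isZero hZ
    obtain ⟨l, rfl⟩ := (ModuleCat.epi_iff_surjective p).1 inferInstance z
    have hi := ModuleCat.injective_of_mono i
    have hj := ModuleCat.injective_of_mono j
    refine ⟨j.hom l, i.hom (p.hom l), (map_ne_zero_iff _ hi).2 hz, fun a ha => ?_⟩
    rw [← map_smul, map_eq_zero_iff _ hj] at ha
    rw [← map_smul, ← map_smul, ha, map_zero, map_zero]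
  · rintro ⟨s, h, hh, ha⟩
    exact exists_mono_isSubquotient _ _ (ModuleCat.ofElement_ne_zero hh)
      (ModuleCat.kernel_ι_ofElement ha)

lemma ModuleCat.cokernel_π_eq_zero_iff {L H : ModuleCat.{u} R} (i : L ⟶ H) (y : H) :
    (cokernel.π i).hom y = 0 ↔ y ∈ LinearMap.range i.hom := by
  have h := ShortComplex.exact_cokernel i
  rw [ShortComplex.moduleCat_exact_iff] at h
  constructor
  · exact h y
  · rintro ⟨x, rfl⟩
    exact congrArg (fun f => f.hom x) (cokernel.condition i)

lemma ModuleCat.isMonoform_iff {H : ModuleCat.{u} R} :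
    IsMonoform H ↔ ¬ IsZero H ∧ ∀ L : Submodule R H, L ≠ ⊥ → ∀ x y : H, x ≠ 0 →
      ¬ ∀ a : R, a • x = 0 ↔ a • y ∈ L := by
  constructor
  · refine fun hH => ⟨hH.not_isZero, fun L hL x y hx h => ?_⟩
    let i : ModuleCat.of R L ⟶ H := ModuleCat.ofHom L.subtype
    have : Mono i := (ModuleCat.mono_iff_injective i).2 Subtype.val_injective
    obtain ⟨l, hl, hl0⟩ := L.ne_bot_iff.1 hL
    refine hH.not_common _ i (ModuleCat.not_isZero_of_ne_zero
      (x := (⟨l, hl⟩ : L)) fun h => hl0 (congrArg Subtype.val h))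
      (ModuleCat.haveCommonNonzeroSubobject_iff.2 ⟨x, (cokernel.π i).hom y, hx, fun a => ?_⟩)
    rw [h, ← map_smul, ModuleCat.cokernel_π_eq_zero_iff]
    change _ ↔ _ ∈ LinearMap.range L.subtype
    rw [Submodule.range_subtype]
  · refine fun ⟨h0, h⟩ => ⟨h0, fun L i _ hL hc => ?_⟩
    obtain ⟨x, y, hx, hxy⟩ := ModuleCat.haveCommonNonzeroSubobject_iff.1 hc
    obtain ⟨y, rfl⟩ := (ModuleCat.epi_iff_surjective (cokernel.π i)).1 inferInstance y
    obtain ⟨l, hl⟩ := ModuleCat.exists_ne_zero_of_not_isZero hL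
    refine h (LinearMap.range i.hom) ?_ x y hx fun a => ?_
    · rw [Submodule.ne_bot_iff]
      exact ⟨_, ⟨l, rfl⟩, (map_ne_zero_iff _ (ModuleCat.injective_of_mono i)).2 hl⟩
    · rw [hxy, ← ModuleCat.cokernel_π_eq_zero_iff, map_smul]

end Modules

/-! ### Annihilators of cycles in dg modules. -/

section DG

open DirectSum MulOpposite

namespace DGMod

variable {A : DGRing.{u}}

/-- A dg ring as a right dg module over itself. -/
def regular (A : DGRing.{u}) : DGMod A where
  carrier := A.carrier
  gr := A.gr
  isInternal := DirectSum.Decomposition.isInternal A.gr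
  smul_mem i j x a hx ha := by
    rw [op_smul_eq_mul]; exact SetLike.mul_mem_graded hx ha
  d := A.d
  d_mem := A.d_mem
  d_d := A.d_d
  leibniz i x a hx := by
    simp only [op_smul_eq_mul]; exact A.leibniz i x a hx

lemma not_isZero_of_ne_zero {M : DGMod A} {x : M.carrier} (h : x ≠ 0) : ¬ IsZero M := fun h' =>
  h (LinearMap.congr_fun (congrArg lin (h'.eq_of_src (𝟙 M) 0)) x)

lemma exists_homogeneous_ne_zero {M : DGMod A} {x : M.carrier} (hx : x ≠ 0) :
    ∃ i, M.proj i x ≠ 0 := by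
  by_contra! h
  obtain ⟨s, _, h2⟩ := M.exists_sum_proj x
  exact hx (by rw [h2, Finset.sum_eq_zero fun i _ => h i])

lemma exists_cycle_of_not_isZero {M : DGMod A} (h : ¬ IsZero M) :
    ∃ k, ∃ z ∈ M.gr k, z ≠ 0 ∧ M.d z = 0 := by
  have : ∃ x : M.carrier, x ≠ 0 := by
    by_contra! h'
    refine h ((IsZero.iff_id_eq_zero M).2 (hom_ext fun x => ?_))
    rw [h' x, map_zero, map_zero]
  obtain ⟨x, hx⟩ := this
  obtain ⟨i, hi⟩ := exists_homogeneous_ne_zero hx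
  by_cases hd : M.d (M.proj i x) = 0
  · exact ⟨i, _, M.proj_mem i x, hi, hd⟩
  · exact ⟨i + 1, _, M.d_mem _ _ (M.proj_mem i x), hd, M.d_d _⟩

lemma d_smul_of_cycle {M : DGMod A} {k : ℤ} {z : M.carrier} (hz : z ∈ M.gr k) (hd : M.d z = 0)
    (a : A.carrier) : M.d (op a • z) = k.negOnePow • (op (A.d a) • z) := by
  rw [M.leibniz k z a hz, hd, smul_zero, zero_add]

/-- The morphism `A[-k] ⟶ M` given by a cycle of degree `k`. -/
def ofCycle {M : DGMod A} {k : ℤ} {z : M.carrier} (hz : z ∈ M.gr k) (hd : M.d z = 0) :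
    shiftObj (-k) (regular A) ⟶ M where
  toLin :=
    { toFun := fun a : A.carrier => op a • z
      map_add' := fun a b => add_smul (op (show A.carrier from a)) (op (show A.carrier from b)) z
      map_smul' := fun a b => mul_smul a (op (show A.carrier from b)) z }
  map_gr i a ha := by
    have := M.smul_mem k (-k + i) z a hz ha
    rwa [add_neg_cancel_left] at this
  map_d := fun (a : A.carrier) => by
    -- The sign in the differential of the shift cancels the Leibniz sign of a cycle of degree `k`.
    change op ((-k).negOnePow • A.d a) • z = M.d (op a • z)
    rw [d_smul_of_cycle hz hd, Int.negOnePow_neg]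
    rcases Int.units_eq_one_or k.negOnePow with h | h <;> simp [h]

lemma lin_ofCycle {M : DGMod A} {k : ℤ} {z : M.carrier} (hz : z ∈ M.gr k) (hd : M.d z = 0)
    (a : A.carrier) : lin (ofCycle hz hd) a = op a • z := rfl

lemma ofCycle_ne_zero {M : DGMod A} {k : ℤ} {z : M.carrier} (hz : z ∈ M.gr k) (hd : M.d z = 0)
    (h0 : z ≠ 0) : ofCycle hz hd ≠ 0 := fun h => h0 (by
  have := LinearMap.congr_fun (congrArg lin h) (1 : A.carrier)
  rw [lin_ofCycle, op_one, one_smul] at this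
  exact this)

lemma kernel_ι_ofCycle {M N : DGMod A} {k : ℤ} {z : M.carrier} {w : N.carrier}
    (hz : z ∈ M.gr k) (hd : M.d z = 0) (hw : w ∈ N.gr k) (hdw : N.d w = 0)
    (h : ∀ a : A.carrier, op a • z = 0 → op a • w = 0) :
    kernel.ι (ofCycle hz hd) ≫ ofCycle hw hdw = 0 :=
  hom_ext fun t => h _ (LinearMap.congr_fun (congrArg lin (kernel.condition (ofCycle hz hd))) t)

/-- Both cycles are images of `1` under morphisms from the same `A[-k]`, with equal kernels; this is
why they must have the same degree. -/
lemma haveCommonNonzeroSubobject_of_cycle {M N : DGMod A} {k : ℤ} {z : M.carrier}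
    {w : N.carrier} (hz : z ∈ M.gr k) (hd : M.d z = 0) (hw : w ∈ N.gr k) (hdw : N.d w = 0)
    (h0 : z ≠ 0) (h : ∀ a : A.carrier, op a • z = 0 ↔ op a • w = 0) :
    HaveCommonNonzeroSubobject M N :=
  haveCommonNonzeroSubobject_of_kernel _ _ (ofCycle_ne_zero hz hd h0)
    (kernel_ι_ofCycle hz hd hw hdw fun a => (h a).1)
    (kernel_ι_ofCycle hw hdw hz hd fun a => (h a).2)

lemma exists_cycle_of_haveCommonNonzeroSubobject {M N : DGMod A}
    (h : HaveCommonNonzeroSubobject M N) :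
    ∃ k, ∃ z ∈ M.gr k, ∃ w ∈ N.gr k, z ≠ 0 ∧ w ≠ 0 ∧ M.d z = 0 ∧ N.d w = 0 ∧
      ∀ a : A.carrier, op a • z = 0 ↔ op a • w = 0 := by
  obtain ⟨Z, i, j, _, _, hZ⟩ := h
  obtain ⟨k, z, hz, h0, hd⟩ := exists_cycle_of_not_isZero hZ
  have hi := injective_of_mono i
  have hj := injective_of_mono j
  refine ⟨k, lin i z, lin_gr i hz, lin j z, lin_gr j hz, (map_ne_zero_iff _ hi).2 h0,
    (map_ne_zero_iff _ hj).2 h0, by rw [← lin_d, hd, map_zero], by rw [← lin_d, hd, map_zero],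
    fun a => ?_⟩
  rw [← map_smul, ← map_smul, map_eq_zero_iff _ hi, map_eq_zero_iff _ hj]

lemma mk_mem_atomSupp_of_cycle {H M : DGMod A} (hH : IsMonoform H) {k : ℤ} {z : M.carrier}
    {w : H.carrier} (hz : z ∈ M.gr k) (hd : M.d z = 0) (hw : w ∈ H.gr k) (hdw : H.d w = 0)
    (h0 : w ≠ 0) (h : ∀ a : A.carrier, op a • z = 0 → op a • w = 0) :
    AtomSpectrum.mk H hH ∈ atomSupp M :=
  mk_mem_atomSupp_iff.2 (exists_mono_isSubquotient _ _ (ofCycle_ne_zero hw hdw h0)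
    (kernel_ι_ofCycle hz hd hw hdw h))

/-- Only `w` is a cycle: `m` lifts a cycle through an epimorphism, and such a lift can be made
homogeneous but need not be closed. -/
lemma exists_of_mk_mem_atomSupp {H M : DGMod A} {hH : IsMonoform H}
    (h : AtomSpectrum.mk H hH ∈ atomSupp M) :
    ∃ k, ∃ m ∈ M.gr k, ∃ w ∈ H.gr k, w ≠ 0 ∧ H.d w = 0 ∧
      ∀ a : A.carrier, op a • m = 0 → op a • w = 0 := by
  obtain ⟨Z, i, _, hZ, L, j, p, _, _⟩ := mk_mem_atomSupp_iff.1 h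
  obtain ⟨k, z, hz, h0, hd⟩ := exists_cycle_of_not_isZero hZ
  have hi := injective_of_mono i
  have hj := injective_of_mono j
  obtain ⟨l, rfl⟩ := surjective_of_epi p z
  have hl : lin p (L.proj k l) = lin p l := by rw [lin_proj, Z.proj_same hz]
  refine ⟨k, lin j (L.proj k l), lin_gr j (L.proj_mem k l), lin i (lin p l), lin_gr i hz,
    (map_ne_zero_iff _ hi).2 h0, by rw [← lin_d, hd, map_zero], fun a ha => ?_⟩
  rw [← map_smul, map_eq_zero_iff _ hj] at ha
  rw [← hl, ← map_smul, ← map_smul, ha, map_zero, map_zero]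

/-- A morphism with nonzero kernel from a monoform dg module does not admit two cycles with the
same annihilator, one in the source and one in its image. -/
lemma false_of_isMonoform {Z N : DGMod A} (hZ : IsMonoform Z) (g : Z ⟶ N) {l : Z.carrier}
    (hl : l ≠ 0) (hgl : lin g l = 0) {k : ℤ} {x y : Z.carrier} (hx : x ∈ Z.gr k)
    (hy : y ∈ Z.gr k) (hdx : Z.d x = 0) (hdy : Z.d y = 0) (h0 : x ≠ 0)
    (h : ∀ a : A.carrier, op a • x = 0 ↔ op a • lin g y = 0) : False := by
  refine hZ.not_common (kernel g) (kernel.ι g) (fun hk => hl ?_) ?_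
  · have : Mono g := Preadditive.mono_of_kernel_zero (hk.eq_of_src _ _)
    exact injective_of_mono g (hgl.trans (map_zero _).symm)
  -- The coimage of `g` is `Z / ker g` and embeds into `N`, so the class of `y` has the annihilator
  -- of its image under `g`.
  · have hinj := injective_of_mono (Abelian.factorThruCoimage g)
    have hfac : ∀ t, lin (Abelian.factorThruCoimage g) (lin (Abelian.coimage.π g) t) = lin g t :=
      fun t => LinearMap.congr_fun (congrArg lin (Abelian.coimage.fac g)) t
    refine haveCommonNonzeroSubobject_of_cycle hx hdx (lin_gr (Abelian.coimage.π g) hy)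
      (by rw [← lin_d, hdy, map_zero]) h0 fun a => ?_
    rw [h, ← hfac, ← map_smul]
    exact map_eq_zero_iff _ hinj

/-! ### Cycles and disks -/

section Disk

variable (hA : A.IsNonpositive) (H : ModuleCat.{u} A.degZeroᵐᵒᵖ) (n : ℤ)

/-- The element of the top component of `D(H)[n]` given by an element of `H`. -/
def diskElt (h : H) : ((D hA H)⟦n⟧).carrier := ((0, h) : H × H)

lemma diskElt_mem (h : H) {k : ℤ} (hk : k = -n) : diskElt hA H n h ∈ ((D hA H)⟦n⟧).gr k := by
  subst hk
  change ((0, h) : H × H) ∈ diskGr H (n + -n)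
  exact ⟨fun _ => rfl, fun h => absurd (add_neg_cancel n) h⟩

lemma d_diskElt (h : H) : ((D hA H)⟦n⟧).d (diskElt hA H n h) = 0 :=
  smul_zero (A := H × H) n.negOnePow

lemma diskElt_injective : Function.Injective (diskElt hA H n) :=
  fun _ _ h => congrArg (Prod.snd (α := H) (β := H)) h

lemma diskElt_zero : diskElt hA H n 0 = 0 := rfl

lemma diskElt_eq_zero_iff {h : H} : diskElt hA H n h = 0 ↔ h = 0 :=
  (diskElt_injective hA H n).eq_iff' rfl

lemma smul_diskElt_eq_zero_iff (h : H) (a : A.carrier) :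
    op a • diskElt hA H n h = 0 ↔
      op (A.degZeroPart a) • h = 0 ∧ op (A.degZeroPart (A.d a)) • h = 0 := by
  change ((op (A.degZeroPart a) • (0 : H) + op (A.degZeroPart (A.d a)) • h,
    op (A.degZeroPart a) • h) : H × H) = 0 ↔ _
  rw [smul_zero, zero_add, Prod.mk_eq_zero, and_comm]

lemma smul_diskElt (h : H) (a : A.degZero) :
    op (a : A.carrier) • diskElt hA H n h = diskElt hA H n (op a • h) := by
  change ((op (A.degZeroPart a) • (0 : H) + op (A.degZeroPart (A.d a)) • h,
    op (A.degZeroPart a) • h) : H × H) = (0, op a • h)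
  have h0 : A.degZeroPart a = a := Subtype.ext (A.degZeroPart_of_mem a.2)
  rw [hA.d_eq_zero a.2, h0, smul_zero, map_zero, MulOpposite.op_zero, zero_smul, zero_add]

/-- Up to sign the differential is `(x, y) ↦ (0, x)`, so its kernel is the second copy of `H`, which
sits in degree `-n`. -/
lemma exists_eq_diskElt {k : ℤ} {z : ((D hA H)⟦n⟧).carrier} (hz : z ∈ ((D hA H)⟦n⟧).gr k)
    (hd : ((D hA H)⟦n⟧).d z = 0) (h0 : z ≠ 0) :
    k = -n ∧ ∃ h : H, h ≠ 0 ∧ z = diskElt hA H n h := by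
  obtain ⟨x, y⟩ : H × H := z
  have hx : x = 0 := by
    have h1 : n.negOnePow • ((0, x) : H × H) = 0 := hd
    rw [smul_eq_zero_iff_eq] at h1
    exact congrArg Prod.snd h1
  subst hx
  have hy : y ≠ 0 := fun hy => h0 (by rw [hy]; rfl)
  refine ⟨?_, y, hy, rfl⟩
  by_contra hk
  have hz' : ((0, y) : H × H) ∈ diskGr H (n + k) := hz
  exact hy (hz'.2 fun h => hk (by omega))

/-- The morphism `D(H)[n] ⟶ D(K)[n]` induced by a linear map. -/
noncomputable def diskMap {H K : ModuleCat.{u} A.degZeroᵐᵒᵖ} (f : H ⟶ K) : (D hA H)⟦n⟧ ⟶ (D hA K)⟦n⟧ :=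
  (shiftFunctor (DGMod A) n).map
    ({ toLin :=
        { toFun := fun p : H × H => ((f.hom p.1, f.hom p.2) : K × K)
          map_add' := fun p q => Prod.ext (map_add f.hom _ _) (map_add f.hom _ _)
          map_smul' := fun a p => by
            refine Prod.ext ?_ ?_
            · change f.hom (op (A.degZeroPart a.unop) • p.1 +
                op (A.degZeroPart (A.d a.unop)) • p.2) = op (A.degZeroPart a.unop) • f.hom p.1 +
                op (A.degZeroPart (A.d a.unop)) • f.hom p.2
              rw [map_add, map_smul, map_smul]
            · exact map_smul f.hom (op (A.degZeroPart a.unop)) p.2 }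
       map_gr := fun i p hp => ⟨fun h => by
          change f.hom p.1 = 0
          rw [hp.1 h, map_zero], fun h => by
          change f.hom p.2 = 0
          rw [hp.2 h, map_zero]⟩
       map_d := fun p => Prod.ext (map_zero f.hom) rfl } : D hA H ⟶ D hA K)

lemma lin_diskMap {H K : ModuleCat.{u} A.degZeroᵐᵒᵖ} (f : H ⟶ K) (h : H) :
    lin (diskMap hA n f) (diskElt hA H n h) = diskElt hA K n (f.hom h) :=
  Prod.ext (map_zero f.hom) rfl

end Disk

lemma lin_cokernel_π_eq_zero_iff {L M : DGMod A} (i : L ⟶ M) (y : M.carrier) :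
    lin (cokernel.π i) y = 0 ↔ y ∈ LinearMap.range (lin i) := by
  constructor
  · intro h
    have h' : lin (cokernel.desc i _ (comp_quotπ_eq_zero i)) (lin (cokernel.π i) y) =
        lin (M.quotπ _ (isDGSubmodule_range i)) y :=
      LinearMap.congr_fun (congrArg lin (cokernel.π_desc i _ (comp_quotπ_eq_zero i))) y
    rw [h, map_zero] at h'
    exact (Submodule.Quotient.mk_eq_zero _).1 h'.symm
  · rintro ⟨x, rfl⟩
    exact LinearMap.congr_fun (congrArg lin (cokernel.condition i)) x

/-! ### Dg submodules generated by a cycle of lowest degree. -/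

lemma _root_.DGRing.exists_sum_proj (a : A.carrier) :
    ∃ s : Finset ℤ, ∑ i ∈ s, (decompose A.gr a i : A.carrier) = a := by
  classical
  exact ⟨_, sum_support_decompose A.gr a⟩

lemma proj_smul {M : DGMod A} {k : ℤ} {z : M.carrier} (hz : z ∈ M.gr k) (a : A.carrier) (i : ℤ) :
    M.proj i (op a • z) = op (decompose A.gr a (i - k) : A.carrier) • z := by
  induction a using A.induction_gr with
  | h0 => simp
  | ha y z hy hz => simp [add_smul, hy, hz]
  | hg j a ha =>
    have h := M.smul_mem k j z a hz ha
    by_cases hj : k + j = i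
    · subst hj
      rw [M.proj_same h, add_sub_cancel_left, decompose_of_mem_same A.gr ha]
    · rw [M.proj_ne h hj, decompose_of_mem_ne A.gr ha (by omega), MulOpposite.op_zero, zero_smul]

lemma smul_eq_of_mem {M : DGMod A} {k : ℤ} {z : M.carrier} (hz : z ∈ M.gr k) {a : A.carrier}
    {i : ℤ} (h : op a • z ∈ M.gr i) :
    op a • z = op (decompose A.gr a (i - k) : A.carrier) • z := by
  rw [← proj_smul hz, M.proj_same h]

/-- A nonzero dg module over a bounded dg ring has a nonzero cycle `z` such that every homogeneous
nonzero cycle in `z A` has the same degree as `z`. -/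
lemma exists_minimal_cycle (hA : A.IsNonpositive) (hb : A.IsBounded) {X : DGMod A} (hX : ¬ IsZero X) :
    ∃ k, ∃ z ∈ X.gr k, z ≠ 0 ∧ X.d z = 0 ∧ ∀ (a : A.carrier) (i : ℤ), op a • z ∈ X.gr i →
      X.d (op a • z) = 0 → i ≠ k → op a • z = 0 := by
  obtain ⟨N, hN⟩ := hb
  obtain ⟨k, z, hz, h0, hd⟩ := exists_cycle_of_not_isZero hX
  let P : ℤ → Prop := fun j => ∃ a : A.carrier, op a • z ∈ X.gr j ∧ op a • z ≠ 0 ∧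
    X.d (op a • z) = 0
  -- A nonzero multiple of `w` in degree `i` needs `A^(i - l) ≠ 0`, hence `-N ≤ i - l ≤ 0`.
  have hdeg : ∀ {w : X.carrier} {l : ℤ}, w ∈ X.gr l → ∀ (a : A.carrier) (i : ℤ),
      op a • w ∈ X.gr i → op a • w ≠ 0 → l - N ≤ i ∧ i ≤ l := by
    intro w l hw a i hi hne
    rw [smul_eq_of_mem hw hi] at hne
    have hne' : A.gr (i - l) ≠ ⊥ := fun h => hne (by
      have := (decompose A.gr a (i - l)).2
      have h' : (decompose A.gr a (i - l) : A.carrier) = 0 := (AddSubgroup.ext_iff.1 h _).1 this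
      rw [h', MulOpposite.op_zero, zero_smul])
    have h1 : |i - l| ≤ N := not_lt.1 fun h => hne' (hN _ h)
    have h2 : i - l ≤ 0 := not_lt.1 fun h => hne' (hA _ h)
    rw [abs_le] at h1
    omega
  obtain ⟨j, ⟨a, haj, ha0, had⟩, hmin⟩ := Int.exists_least_of_bdd (P := P)
    ⟨k - N, fun j ⟨a, haj, ha0, _⟩ => (hdeg hz a j haj ha0).1⟩
    ⟨k, 1, by rwa [op_one, one_smul], by rwa [op_one, one_smul], by rwa [op_one, one_smul]⟩
  refine ⟨j, op a • z, haj, ha0, had, fun b i hb hbd hij => ?_⟩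
  by_contra hne
  -- Non-positivity gives `i ≤ j`, and minimality of `j` gives `j ≤ i`.
  have h1 := (hdeg haj b i hb hne).2
  have h2 := hmin i ⟨a * b, by rwa [op_mul, mul_smul], by rwa [op_mul, mul_smul],
    by rwa [op_mul, mul_smul]⟩
  omega

/-- The annihilator of a cycle `z` for which `z A` has nonzero cycles in one degree only. -/
lemma smul_eq_zero_iff_of_minimal {X : DGMod A} {k : ℤ} {z : X.carrier} (hz : z ∈ X.gr k)
    (hd : X.d z = 0) (hmin : ∀ (a : A.carrier) (i : ℤ), op a • z ∈ X.gr i →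
      X.d (op a • z) = 0 → i ≠ k → op a • z = 0) (a : A.carrier) :
    op a • z = 0 ↔ op (A.degZeroPart a : A.carrier) • z = 0 ∧
      op (A.degZeroPart (A.d a) : A.carrier) • z = 0 := by
  have hproj : ∀ a : A.carrier, op a • z = 0 → op (A.degZeroPart a : A.carrier) • z = 0 := by
    intro a ha
    have := proj_smul hz a k
    rw [ha, map_zero, sub_self] at this
    exact this.symm
  have hda : ∀ a : A.carrier, X.d (op a • z) = 0 ↔ op (A.d a) • z = 0 := fun a => by
    rw [d_smul_of_cycle hz hd, smul_eq_zero_iff_eq]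
  constructor
  · exact fun ha => ⟨hproj a ha, hproj _ ((hda a).1 (by rw [ha, map_zero]))⟩
  · rintro ⟨h1, h2⟩
    -- the components of degree different from `-1` and `0`, and then of degree `-1`
    have key : ∀ i, i ≠ 0 → ∀ b ∈ A.gr i, op (A.d b) • z = 0 → op b • z = 0 := fun i hi b hb h =>
      hmin b (k + i) (X.smul_mem k i z b hz hb) ((hda b).2 h) (by omega)
    -- `z d(b)` is a cycle of degree `k + i + 1 ≠ k`, hence zero. So `zb` is itself a cycle outside
    -- degree `k`.
    have key' : ∀ i, i ≠ 0 → i ≠ -1 → ∀ b ∈ A.gr i, op b • z = 0 := fun i hi hi' b hb =>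
      key i hi b hb (key (i + 1) (by omega) _ (A.d_mem i b hb)
        (by rw [A.d_d, MulOpposite.op_zero, zero_smul]))
    have hdec : A.degZeroPart (A.d a) = A.d (decompose A.gr a (-1) : A.carrier) := by
      clear h1 h2
      induction a using A.induction_gr with
      | h0 => simp
      | ha y z hy hz => simp [hy, hz]
      | hg i a ha =>
        by_cases hi : i = -1
        · subst hi
          rw [decompose_of_mem_same A.gr ha]
          exact A.degZeroPart_of_mem (A.d_mem _ a ha)
        · rw [decompose_of_mem_ne A.gr ha hi, A.degZeroPart_of_mem_ne (A.d_mem i a ha) (by omega),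
            map_zero]
          rfl
    obtain ⟨s, hs⟩ := DGRing.exists_sum_proj a
    rw [← hs]
    change opAddEquiv (∑ i ∈ s, (decompose A.gr a i : A.carrier)) • z = 0
    rw [map_sum, Finset.sum_smul]
    refine Finset.sum_eq_zero fun i _ => ?_
    by_cases hi : i = 0
    · subst hi; exact h1
    · by_cases hi' : i = -1
      · subst hi'
        exact key _ hi _ (decompose A.gr a (-1)).2 (by rw [← hdec]; exact h2)
      · exact key' i hi hi' _ (decompose A.gr a i).2

/-! ### Monoform disks, and a disk for every monoform dg module. -/

section Disk

variable (hA : A.IsNonpositive)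

lemma eq_diskElt_of_mem {H : ModuleCat.{u} A.degZeroᵐᵒᵖ} {n : ℤ} {z : ((D hA H)⟦n⟧).carrier}
    (hz : z ∈ ((D hA H)⟦n⟧).gr (-n)) : ∃ h : H, z = diskElt hA H n h := by
  obtain ⟨x, y⟩ : H × H := z
  have hz' : ((x, y) : H × H) ∈ diskGr H (n + -n) := hz
  obtain rfl : x = 0 := hz'.1 (by omega)
  exact ⟨y, rfl⟩

/-- The disk of a monoform module is monoform. -/
theorem isMonoform_disk {H : ModuleCat.{u} A.degZeroᵐᵒᵖ} (hH : IsMonoform H) (n : ℤ) :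
    IsMonoform ((D hA H)⟦n⟧) where
  not_isZero := by
    obtain ⟨x, hx⟩ := ModuleCat.exists_ne_zero_of_not_isZero hH.not_isZero
    exact not_isZero_of_ne_zero (mt (diskElt_eq_zero_iff hA H n).1 hx)
  not_common L i _ hL hc := by
    obtain ⟨k, z, hz, w, hw, h0, -, hdz, -, hzw⟩ := exists_cycle_of_haveCommonNonzeroSubobject hc
    obtain ⟨rfl, h, hh, rfl⟩ := exists_eq_diskElt hA H n hz hdz h0
    obtain ⟨y, rfl⟩ := surjective_of_epi (cokernel.π i) w
    -- As `w` is homogeneous of degree `-n`, the component of `y` in that degree still lifts it, and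
    -- it has the form `(0, y')`.
    obtain ⟨y', hy'⟩ := eq_diskElt_of_mem hA (proj_mem _ (-n) y)
    obtain ⟨m, l, hl, hl0, hdl⟩ := exists_cycle_of_not_isZero hL
    have hi := injective_of_mono i
    obtain ⟨-, l', hl', hll'⟩ := exists_eq_diskElt hA H n (lin_gr i hl)
      (by rw [← lin_d, hdl, map_zero]) ((map_ne_zero_iff _ hi).2 hl0)
    -- The trace of `L` on the top copy of `H`. It is nonzero because `L` contains a nonzero cycle,
    -- and it violates the monoformity of `H`.
    let L' : Submodule A.degZeroᵐᵒᵖ H :=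
      { carrier := {x | diskElt hA H n x ∈ LinearMap.range (lin i)}
        add_mem' := fun {x y} hx hy => by
          have : diskElt hA H n (x + y) = diskElt hA H n x + diskElt hA H n y :=
            Prod.ext (add_zero (0 : H)).symm rfl
          rw [Set.mem_ofPred_eq, this]
          exact add_mem hx hy
        zero_mem' := by
          rw [Set.mem_ofPred_eq, diskElt_zero]
          exact zero_mem _
        smul_mem' := fun a x hx => by
          rw [Set.mem_ofPred_eq, ← op_unop a, ← smul_diskElt]
          exact Submodule.smul_mem _ _ hx }
    refine (ModuleCat.isMonoform_iff.1 hH).2 L' ?_ h y' hh fun a => ?_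
    · rw [Submodule.ne_bot_iff]
      exact ⟨l', ⟨l, hll'⟩, hl'⟩
    · rw [← op_unop a]
      change _ ↔ diskElt hA H n _ ∈ LinearMap.range (lin i)
      rw [← smul_diskElt, ← hy', ← lin_cokernel_π_eq_zero_iff, map_smul, lin_proj,
        proj_same _ hw, ← hzw, smul_diskElt, diskElt_eq_zero_iff]

lemma smul_diskElt_eq_zero_of_imp {H K : ModuleCat.{u} A.degZeroᵐᵒᵖ} {h : H} {k : K} (n m : ℤ)
    (hhk : ∀ a : A.degZeroᵐᵒᵖ, a • h = 0 → a • k = 0) (a : A.carrier)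
    (ha : op a • diskElt hA H n h = 0) : op a • diskElt hA K m k = 0 := by
  rw [smul_diskElt_eq_zero_iff] at ha ⊢
  exact ⟨hhk _ ha.1, hhk _ ha.2⟩

lemma smul_eq_zero_of_smul_diskElt {H K : ModuleCat.{u} A.degZeroᵐᵒᵖ} {h : H} {k : K} {n m : ℤ}
    (hhk : ∀ a : A.carrier, op a • diskElt hA H n h = 0 → op a • diskElt hA K m k = 0)
    (a : A.degZeroᵐᵒᵖ) (ha : a • h = 0) : a • k = 0 := by
  have := hhk (a.unop : A.carrier)
  rw [smul_diskElt, smul_diskElt, diskElt_eq_zero_iff, diskElt_eq_zero_iff] at this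
  exact this ha

/-- Common cycles have a common degree, which is both `-n` and `-m`. Restricting their annihilators
to `A^0` recovers those in `H` and `K`. -/
theorem haveCommonNonzeroSubobject_disk_iff {H K : ModuleCat.{u} A.degZeroᵐᵒᵖ} {n m : ℤ} :
    HaveCommonNonzeroSubobject ((D hA H)⟦n⟧) ((D hA K)⟦m⟧) ↔
      n = m ∧ HaveCommonNonzeroSubobject H K := by
  constructor
  · intro hc
    obtain ⟨k, z, hz, w, hw, h0, h0', hdz, hdw, hzw⟩ :=
      exists_cycle_of_haveCommonNonzeroSubobject hc
    obtain ⟨hk, h, hh, rfl⟩ := exists_eq_diskElt hA H n hz hdz h0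
    obtain ⟨hk', h', hh', rfl⟩ := exists_eq_diskElt hA K m hw hdw h0'
    exact ⟨by omega, ModuleCat.haveCommonNonzeroSubobject_iff.2 ⟨h, h', hh, fun a =>
      ⟨smul_eq_zero_of_smul_diskElt hA (fun a => (hzw a).1) a,
        smul_eq_zero_of_smul_diskElt hA (fun a => (hzw a).2) a⟩⟩⟩
  · rintro ⟨rfl, hc⟩
    obtain ⟨x, y, hx, hxy⟩ := ModuleCat.haveCommonNonzeroSubobject_iff.1 hc
    exact haveCommonNonzeroSubobject_of_cycle (diskElt_mem hA H n x rfl) (d_diskElt hA H n x)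
      (diskElt_mem hA K n y rfl) (d_diskElt hA K n y) (mt (diskElt_eq_zero_iff hA H n).1 hx)
      fun a => ⟨smul_diskElt_eq_zero_of_imp hA n n (fun a => (hxy a).1) a,
        smul_diskElt_eq_zero_of_imp hA n n (fun a => (hxy a).2) a⟩

theorem exists_disk_of_isMonoform (hb : A.IsBounded) {X : DGMod A} (hX : IsMonoform X) :
    ∃ (H : ModuleCat.{u} A.degZeroᵐᵒᵖ) (n : ℤ),
      IsMonoform H ∧ HaveCommonNonzeroSubobject X ((D hA H)⟦n⟧) := by
  obtain ⟨k, z, hz, h0, hd, hmin⟩ := exists_minimal_cycle hA hb hX.not_isZero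
  let z' : X.toDegZeroModule := z
  -- `H = zA^0`, where `z` has degree `k`; the shift by `-k` puts the top copy of `H` in degree `k`.
  let H : ModuleCat.{u} A.degZeroᵐᵒᵖ :=
    ModuleCat.of _ (Submodule.span A.degZeroᵐᵒᵖ {z'})
  let h : H := (⟨z', Submodule.mem_span_singleton_self z'⟩ : Submodule.span A.degZeroᵐᵒᵖ {z'})
  have hsmul : ∀ a : A.degZeroᵐᵒᵖ, a • h = 0 ↔ op (a.unop : A.carrier) • z = 0 := fun a =>
    Subtype.ext_iff
  have hgen : ∀ x : H, ∃ a : A.degZeroᵐᵒᵖ, x = a • h := by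
    rintro ⟨x, hx⟩
    obtain ⟨a, rfl⟩ := Submodule.mem_span_singleton.1 hx
    exact ⟨a, rfl⟩
  have hh : h ≠ 0 := fun h' => h0 (congrArg Subtype.val h')
  have hann : ∀ a : A.carrier, op a • z = 0 ↔ op a • diskElt hA H (-k) h = 0 := fun a => by
    rw [smul_eq_zero_iff_of_minimal hz hd hmin, smul_diskElt_eq_zero_iff, hsmul, hsmul]
    rfl
  have hmem : ∀ x : H, diskElt hA H (-k) x ∈ ((D hA H)⟦-k⟧).gr k := fun x =>
    diskElt_mem hA H (-k) x (neg_neg k).symm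
  have hne := mt (diskElt_eq_zero_iff hA H (-k)).1 hh
  refine ⟨H, -k, ?_, haveCommonNonzeroSubobject_of_cycle hz hd (hmem h)
    (d_diskElt hA H (-k) h) h0 hann⟩
  let f := ofCycle hz hd
  let g := ofCycle (hmem h) (d_diskElt hA H (-k) h)
  let Z := Abelian.coimage f
  let i : Z ⟶ X := Abelian.factorThruCoimage f
  -- `Z` is `zA`. It embeds into `X` by `i` and, by equality of annihilators, into the disk by `j`.
  let j : Z ⟶ (D hA H)⟦-k⟧ := cokernel.desc (kernel.ι f) g
    (kernel_ι_ofCycle hz hd (hmem h) (d_diskElt hA H (-k) h) fun a => (hann a).1)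
  have hi : ∀ a : A.carrier, lin i (lin (Abelian.coimage.π f) a) = op a • z := fun a =>
    LinearMap.congr_fun (congrArg lin (Abelian.coimage.fac f)) a
  have hj : ∀ a : A.carrier, lin j (lin (Abelian.coimage.π f) a) = op a • diskElt hA H (-k) h :=
    fun a => LinearMap.congr_fun (congrArg lin (cokernel.π_desc (kernel.ι f) g _)) a
  have hi_inj : Function.Injective (lin i) := injective_of_mono i
  have hj_inj : Function.Injective (lin j) := by
    rw [injective_iff_map_eq_zero]
    intro t ht
    obtain ⟨a, rfl⟩ := surjective_of_epi (Abelian.coimage.π f) t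
    rw [← map_eq_zero_iff _ hi_inj]
    exact (hi a).trans ((hann a).2 ((hj a).symm.trans ht))
  have hZ : IsMonoform Z := hX.of_mono i (not_isZero_of_ne_zero
    (x := lin (Abelian.coimage.π f) (1 : A.carrier)) fun h1 => h0 (by
      have := hi 1
      rw [h1, map_zero, op_one, one_smul] at this
      exact this.symm))
  -- Since `z` generates `H` over `A^0`, the image of `Z` contains the whole top copy of `H`.
  have hlift : ∀ x : H, ∃ t ∈ Z.gr k, lin j t = diskElt hA H (-k) x := fun x => by
    obtain ⟨a, rfl⟩ := hgen x
    refine ⟨lin (Abelian.coimage.π f) (a.unop : A.carrier), lin_gr _ ?_, (hj _).trans ?_⟩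
    · change (a.unop : A.carrier) ∈ A.gr (-k + k)
      rw [neg_add_cancel]
      exact a.unop.2
    · exact smul_diskElt hA H (-k) h a.unop
  have hcyc : ∀ {t : Z.carrier} {x : H}, lin j t = diskElt hA H (-k) x → Z.d t = 0 :=
    fun ht => hj_inj (by rw [lin_d, ht, d_diskElt, map_zero])
  refine ModuleCat.isMonoform_iff.2 ⟨ModuleCat.not_isZero_of_ne_zero hh, fun L hL x y hx hxy => ?_⟩
  obtain ⟨l, hl, hl0⟩ := L.ne_bot_iff.1 hL
  obtain ⟨t, -, ht⟩ := hlift l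
  obtain ⟨r, hr, hrx⟩ := hlift x
  obtain ⟨s, hs, hsy⟩ := hlift y
  let q : H ⟶ ModuleCat.of A.degZeroᵐᵒᵖ (H ⧸ L) := ModuleCat.ofHom L.mkQ
  have hq : ∀ x, q.hom x = 0 ↔ x ∈ L := fun x => Submodule.Quotient.mk_eq_zero L
  have hG : ∀ {t : Z.carrier} {x : H}, lin j t = diskElt hA H (-k) x →
      lin (j ≫ diskMap hA (-k) q) t = diskElt hA _ (-k) (q.hom x) := fun {t x} ht => by
    rw [lin_comp, LinearMap.comp_apply, ht, lin_diskMap]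
  have hne0 : ∀ {t : Z.carrier} {x : H}, lin j t = diskElt hA H (-k) x → x ≠ 0 → t ≠ 0 := by
    rintro t x ht hx rfl
    rw [map_zero] at ht
    exact hx ((diskElt_eq_zero_iff hA H (-k)).1 ht.symm)
  -- Compare `Z` with its image in `D(H/L)[-k]`: the lift of `l` lies in the kernel, and the lift of
  -- `x` has the annihilator of the image of the lift of `y`.
  refine false_of_isMonoform hZ (j ≫ diskMap hA (-k) q) (hne0 ht hl0) ?_ hr hs (hcyc hrx)
    (hcyc hsy) (hne0 hrx hx) fun a => ?_
  · rw [hG ht, (hq l).2 hl, diskElt_zero]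
  · rw [hG hsy, ← map_eq_zero_iff _ hj_inj, map_smul, hrx, smul_diskElt_eq_zero_iff,
      smul_diskElt_eq_zero_iff, hxy, hxy, ← map_smul, ← map_smul, hq, hq]

end Disk

/-! ### Comparison of supports over `A` and over `A^0`. -/

lemma d_smul_degZero (hA : A.IsNonpositive) {M : DGMod A} {k : ℤ} {x : M.carrier}
    (hx : x ∈ M.gr k) (a : A.degZero) :
    M.d (op (a : A.carrier) • x) = op (a : A.carrier) • M.d x := by
  rw [M.leibniz k x _ hx, hA.d_eq_zero a.2, MulOpposite.op_zero, zero_smul, smul_zero, add_zero]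

/-- Either some summand `m j` already works, or a `b` in `A^0` kills it but not `h`. Multiplying
everything by `b` then removes one summand and keeps the degrees of the others. -/
lemma exists_homogeneous_of_annihilator {M : DGMod A} {H : ModuleCat.{u} A.degZeroᵐᵒᵖ}
    (t : Finset ℤ) (m : ℤ → M.toDegZeroModule) (hm : ∀ i, m i ∈ M.gr i) (h : H) (h0 : h ≠ 0)
    (hs : ∀ a : A.degZeroᵐᵒᵖ, a • ∑ i ∈ t, m i = 0 → a • h = 0) :
    ∃ (k : ℤ) (z : M.toDegZeroModule) (h' : H), z ∈ M.gr k ∧ h' ≠ 0 ∧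
      ∀ a : A.degZeroᵐᵒᵖ, a • z = 0 → a • h' = 0 := by
  classical
  induction t using Finset.induction_on generalizing m h with
  | empty => exact absurd (by simpa using hs 1) h0
  | insert j t hj ih =>
    by_cases hc : ∀ a : A.degZeroᵐᵒᵖ, a • m j = 0 → a • h = 0
    · exact ⟨j, m j, h, hm j, h0, hc⟩
    · push Not at hc
      obtain ⟨b, hb, hbh⟩ := hc
      refine ih (fun i => b • m i) (fun i => ?_) (b • h) hbh fun a ha => ?_
      · have := M.smul_mem i 0 (m i) _ (hm i) b.unop.2
        rwa [add_zero] at this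
      · rw [← mul_smul]
        refine hs _ ?_
        rw [Finset.sum_insert hj, smul_add, mul_smul, hb, smul_zero, zero_add, mul_smul,
          Finset.smul_sum (r := b)]
        exact ha

/-- If the annihilator in `A⁰` of an element of `M` is contained in that of a nonzero element of
`H`, then the element of `M` can be chosen to be a homogeneous cycle. -/
lemma exists_cycle_of_annihilator (hA : A.IsNonpositive) {M : DGMod A}
    {H : ModuleCat.{u} A.degZeroᵐᵒᵖ} (s : M.toDegZeroModule) (h : H) (h0 : h ≠ 0)
    (hs : ∀ a : A.degZeroᵐᵒᵖ, a • s = 0 → a • h = 0) :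
    ∃ (k : ℤ) (z : M.toDegZeroModule) (h' : H), z ∈ M.gr k ∧ M.d z = 0 ∧ h' ≠ 0 ∧
      ∀ a : A.degZeroᵐᵒᵖ, a • z = 0 → a • h' = 0 := by
  obtain ⟨t, -, ht⟩ := M.exists_sum_proj s
  obtain ⟨k, z, h', hz, hh', hzh⟩ := exists_homogeneous_of_annihilator t (fun i => M.proj i s)
    (fun i => M.proj_mem i s) h h0 fun a ha => hs a (by
      have ht' : s = ∑ i ∈ t, (show M.toDegZeroModule from M.proj i s) := ht
      rw [ht']; exact ha)
  have hd : ∀ a : A.degZeroᵐᵒᵖ,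
      M.d (op (a.unop : A.carrier) • (show M.carrier from z)) =
        op (a.unop : A.carrier) • M.d z := fun a => d_smul_degZero hA hz a.unop
  -- Either the boundary `dz` works, or some `b` kills `dz` but not `h'`, and then `zb` is a cycle
  -- that works.
  by_cases hc : ∀ a : A.degZeroᵐᵒᵖ, a • (show M.toDegZeroModule from M.d z) = 0 → a • h' = 0
  · exact ⟨k + 1, M.d z, h', M.d_mem k z hz, M.d_d z, hh', hc⟩
  · push Not at hc
    obtain ⟨b, hb, hbh⟩ := hc
    refine ⟨k, b • z, b • h', ?_, (hd b).trans hb, hbh, fun a ha => ?_⟩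
    · have := M.smul_mem k 0 z _ hz b.unop.2
      rwa [add_zero] at this
    · rw [← mul_smul] at ha ⊢
      exact hzh _ ha

lemma mk_mem_atomSupp_toDegZeroModule (hA : A.IsNonpositive) {M : DGMod A}
    {H : ModuleCat.{u} A.degZeroᵐᵒᵖ} (hH : IsMonoform H) {n : ℤ}
    (h : AtomSpectrum.mk ((D hA H)⟦n⟧) (isMonoform_disk hA hH n) ∈ atomSupp M) :
    AtomSpectrum.mk H hH ∈ atomSupp M.toDegZeroModule := by
  obtain ⟨k, m, -, w, hw, hw0, hdw, hmw⟩ := exists_of_mk_mem_atomSupp h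
  obtain ⟨-, x, hx, rfl⟩ := exists_eq_diskElt hA H n hw hdw hw0
  refine ModuleCat.mk_mem_atomSupp_iff.2 ⟨m, x, hx, fun a ha => ?_⟩
  have := hmw (a.unop : A.carrier) ha
  rwa [smul_diskElt, diskElt_eq_zero_iff] at this

/-- For a cycle `z`, `za = 0` implies `z d(a) = 0`, and the degree-zero parts of `a` and `d(a)` then
kill `z` too. These two parts control the annihilator of a top element of a disk. -/
lemma exists_mk_mem_atomSupp (hA : A.IsNonpositive) {M : DGMod A}
    {H : ModuleCat.{u} A.degZeroᵐᵒᵖ} (hH : IsMonoform H)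
    (h : AtomSpectrum.mk H hH ∈ atomSupp M.toDegZeroModule) :
    ∃ n : ℤ, AtomSpectrum.mk ((D hA H)⟦n⟧) (isMonoform_disk hA hH n) ∈ atomSupp M := by
  obtain ⟨s, x, hx, hs⟩ := ModuleCat.mk_mem_atomSupp_iff.1 h
  obtain ⟨k, z, x, hz, hd, hx, hzx⟩ := exists_cycle_of_annihilator hA s x hx hs
  refine ⟨-k, mk_mem_atomSupp_of_cycle _ hz hd (diskElt_mem hA H (-k) x (neg_neg k).symm)
    (d_diskElt hA H (-k) x) (mt (diskElt_eq_zero_iff hA H (-k)).1 hx) fun a ha => ?_⟩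
  have h1 : op (A.degZeroPart a : A.carrier) • (show M.carrier from z) = 0 := by
    have := proj_smul hz a k
    rw [ha, map_zero, sub_self] at this
    exact this.symm
  have h2 : op (A.d a) • (show M.carrier from z) = 0 := by
    have := d_smul_of_cycle hz hd a
    rwa [ha, map_zero, eq_comm, smul_eq_zero_iff_eq] at this
  have h3 : op (A.degZeroPart (A.d a) : A.carrier) • (show M.carrier from z) = 0 := by
    have := proj_smul hz (A.d a) k
    rw [h2, map_zero, sub_self] at this
    exact this.symm
  rw [smul_diskElt_eq_zero_iff]
  exact ⟨hzx _ h1, hzx _ h3⟩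

lemma mk_disk_mem_atomSupp_disk (hA : A.IsNonpositive) {N H : ModuleCat.{u} A.degZeroᵐᵒᵖ}
    (hH : IsMonoform H) (n : ℤ) (h : AtomSpectrum.mk H hH ∈ atomSupp N) :
    AtomSpectrum.mk ((D hA H)⟦n⟧) (isMonoform_disk hA hH n) ∈ atomSupp ((D hA N)⟦n⟧) := by
  obtain ⟨s, x, hx, hs⟩ := ModuleCat.mk_mem_atomSupp_iff.1 h
  exact mk_mem_atomSupp_of_cycle _ (diskElt_mem hA N n s rfl) (d_diskElt hA N n s)
    (diskElt_mem hA H n x rfl) (d_diskElt hA H n x) (mt (diskElt_eq_zero_iff hA H n).1 hx)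
    (smul_diskElt_eq_zero_of_imp hA n n hs)

/-- The witness over `A^0` can be taken to be a cycle of `D(N)[m]`, that is, an element of `N`. No
relation between `n` and `m` is needed. -/
lemma mk_mem_atomSupp_of_mk_mem_atomSupp_disk (hA : A.IsNonpositive)
    {N H : ModuleCat.{u} A.degZeroᵐᵒᵖ} (hH : IsMonoform H) {n m : ℤ}
    (h : AtomSpectrum.mk ((D hA H)⟦n⟧) (isMonoform_disk hA hH n) ∈ atomSupp ((D hA N)⟦m⟧)) :
    AtomSpectrum.mk H hH ∈ atomSupp N := by
  obtain ⟨s, x, hx, hs⟩ := ModuleCat.mk_mem_atomSupp_iff.1 (mk_mem_atomSupp_toDegZeroModule hA hH h)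
  obtain ⟨k, z, x, hz, hd, hx, hzx⟩ := exists_cycle_of_annihilator hA s x hx hs
  have hz0 : z ≠ 0 := fun hz0 => hx (by simpa using hzx 1 (by rw [hz0, smul_zero]))
  obtain ⟨-, y, -, rfl⟩ := exists_eq_diskElt hA N m hz hd hz0
  refine ModuleCat.mk_mem_atomSupp_iff.2 ⟨y, x, hx, fun a ha => hzx a ?_⟩
  refine (smul_diskElt hA N m y a.unop).trans ?_
  rw [op_unop, ha]
  rfl

/-! ### The comparison of the spectra -/

section Spectrum

variable (hA : A.IsNonpositive)

/-- The map `(H, n) ↦ D(H)[n]` on atoms. -/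
noncomputable def diskAtom (p : AtomSpectrum (ModuleCat.{u} A.degZeroᵐᵒᵖ) × ℤ) :
    AtomSpectrum (DGMod A) :=
  Quotient.map (fun H : MonoformObj (ModuleCat.{u} A.degZeroᵐᵒᵖ) =>
      (⟨(D hA H.1)⟦p.2⟧, isMonoform_disk hA H.2 p.2⟩ : MonoformObj (DGMod A)))
    (fun _ _ h => (haveCommonNonzeroSubobject_disk_iff hA).2 ⟨rfl, h⟩) p.1

lemma diskAtom_mk {H : ModuleCat.{u} A.degZeroᵐᵒᵖ} (hH : IsMonoform H) (n : ℤ) :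
    diskAtom hA (AtomSpectrum.mk H hH, n) =
      AtomSpectrum.mk ((D hA H)⟦n⟧) (isMonoform_disk hA hH n) := rfl

lemma diskAtom_bijective (hb : A.IsBounded) : Function.Bijective (diskAtom hA) := by
  constructor
  · rintro ⟨α, n⟩ ⟨β, m⟩ h
    obtain ⟨H, hH, rfl⟩ := α.exists_eq_mk
    obtain ⟨K, hK, rfl⟩ := β.exists_eq_mk
    rw [diskAtom_mk, diskAtom_mk, AtomSpectrum.mk_eq_mk_iff,
      haveCommonNonzeroSubobject_disk_iff] at h
    exact Prod.ext (AtomSpectrum.mk_eq_mk_iff.2 h.2) h.1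
  · intro α
    obtain ⟨X, hX, rfl⟩ := α.exists_eq_mk
    obtain ⟨H, n, hH, hc⟩ := exists_disk_of_isMonoform hA hb hX
    exact ⟨(AtomSpectrum.mk H hH, n), (AtomSpectrum.mk_eq_mk_iff.2 hc).symm⟩

lemma vadd_diskAtom (m : ℤ) (α : AtomSpectrum (ModuleCat.{u} A.degZeroᵐᵒᵖ)) (n : ℤ) :
    m +ᵥ diskAtom hA (α, n) = diskAtom hA (α, n + m) := by
  obtain ⟨H, hH, rfl⟩ := α.exists_eq_mk
  exact (AtomSpectrum.mk_eq_of_iso _ ((isMonoform_disk hA hH n).map (shiftFunctor (DGMod A) m))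
    ((shiftFunctorAdd (DGMod A) n m).app (D hA H))).symm

/-- `ℤ` acts by translation on the second factor of the parametrisation, so orbits are the fibres
over the first. -/
lemma orbitProj_diskAtom_eq_iff (hb : A.IsBounded)
    {α β : AtomSpectrum (ModuleCat.{u} A.degZeroᵐᵒᵖ)} {n m : ℤ} :
    orbitProj ℤ (diskAtom hA (α, n)) = orbitProj ℤ (diskAtom hA (β, m)) ↔ α = β := by
  change Quotient.mk _ _ = Quotient.mk _ _ ↔ _
  rw [Quotient.eq, AddAction.orbitRel_apply, AddAction.mem_orbit_iff]
  constructor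
  · rintro ⟨k, hk⟩
    rw [vadd_diskAtom] at hk
    exact congrArg Prod.fst ((diskAtom_bijective hA hb).1 hk).symm
  · rintro rfl
    exact ⟨n - m, by rw [vadd_diskAtom, add_sub_cancel]⟩

/-- The bijection from the atom spectrum of `Mod A⁰` to the orbit atom spectrum of `dgMod A`. -/
noncomputable def orbitDiskEquiv (hb : A.IsBounded) :
    AtomSpectrum (ModuleCat.{u} A.degZeroᵐᵒᵖ) ≃ OrbitAtomSpectrum (DGMod A) ℤ :=
  Equiv.ofBijective (fun α => orbitProj ℤ (diskAtom hA (α, 0)))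
    ⟨fun _ _ h => (orbitProj_diskAtom_eq_iff hA hb).1 h, fun β => by
      obtain ⟨β, rfl⟩ := Quotient.exists_rep β
      obtain ⟨⟨α, n⟩, rfl⟩ := (diskAtom_bijective hA hb).2 β
      exact ⟨α, (orbitProj_diskAtom_eq_iff hA hb).2 rfl⟩⟩

lemma orbitDiskEquiv_symm_apply (hb : A.IsBounded)
    (α : AtomSpectrum (ModuleCat.{u} A.degZeroᵐᵒᵖ)) (n : ℤ) :
    (orbitDiskEquiv hA hb).symm (orbitProj ℤ (diskAtom hA (α, n))) = α :=
  (Equiv.symm_apply_eq _).2 ((orbitProj_diskAtom_eq_iff hA hb).2 rfl)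

lemma image_orbitSupp (hb : A.IsBounded) (M : DGMod A) :
    (orbitDiskEquiv hA hb).symm '' orbitSupp ℤ M = atomSupp M.toDegZeroModule := by
  ext α
  constructor
  · rintro ⟨_, ⟨β, hβ, rfl⟩, rfl⟩
    obtain ⟨⟨α, n⟩, rfl⟩ := (diskAtom_bijective hA hb).2 β
    rw [orbitDiskEquiv_symm_apply]
    obtain ⟨H, hH, rfl⟩ := α.exists_eq_mk
    exact mk_mem_atomSupp_toDegZeroModule hA hH hβ
  · intro hα
    obtain ⟨H, hH, rfl⟩ := α.exists_eq_mk
    obtain ⟨n, hn⟩ := exists_mk_mem_atomSupp hA hH hα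
    exact ⟨_, ⟨_, hn, rfl⟩, orbitDiskEquiv_symm_apply hA hb (AtomSpectrum.mk H hH) n⟩

lemma continuous_orbitDiskEquiv_symm (hb : A.IsBounded) :
    Continuous (orbitDiskEquiv hA hb).symm := by
  refine continuous_generateFrom_iff.2 ?_
  rintro _ ⟨N, rfl⟩
  refine isOpen_coinduced.2 ?_
  -- All shifts are needed, since the preimage of a set of orbits is stable under `ℤ`.
  have : orbitProj ℤ ⁻¹' ((orbitDiskEquiv hA hb).symm ⁻¹' atomSupp N) = ⋃ n : ℤ, atomSupp ((D hA N)⟦n⟧) := by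
    ext β
    obtain ⟨⟨α, n⟩, rfl⟩ := (diskAtom_bijective hA hb).2 β
    change (orbitDiskEquiv hA hb).symm (orbitProj ℤ (diskAtom hA (α, n))) ∈ atomSupp N ↔ _
    rw [orbitDiskEquiv_symm_apply, Set.mem_iUnion]
    obtain ⟨H, hH, rfl⟩ := α.exists_eq_mk
    exact ⟨fun h => ⟨n, mk_disk_mem_atomSupp_disk hA hH n h⟩,
      fun ⟨_, h⟩ => mk_mem_atomSupp_of_mk_mem_atomSupp_disk hA hH h⟩
  change IsOpen (orbitProj ℤ ⁻¹' ((orbitDiskEquiv hA hb).symm ⁻¹' atomSupp N))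
  rw [this]
  exact isOpen_iUnion fun n => isOpen_atomSupp _

lemma continuous_orbitDiskEquiv (hb : A.IsBounded) : Continuous (orbitDiskEquiv hA hb) := by
  refine continuous_def.2 fun U hU => ?_
  have hU' : IsOpen (orbitProj ℤ ⁻¹' U : Set (AtomSpectrum (DGMod A))) := isOpen_coinduced.1 hU
  refine isOpen_iff_forall_mem_open.2 fun α hα => ?_
  obtain ⟨X, hX, hXU⟩ := exists_atomSupp_subset hU' (α := diskAtom hA (α, 0)) hα
  -- The support of `X` over `A^0` corresponds to its orbit support, which lies in `U`; it is the
  -- required open neighbourhood.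
  refine ⟨atomSupp X.toDegZeroModule, ?_, isOpen_atomSupp _, ?_⟩
  · rw [← image_orbitSupp hA hb]
    rintro _ ⟨_, ⟨β, hβ, rfl⟩, rfl⟩
    rw [Set.mem_preimage, Equiv.apply_symm_apply]
    exact hXU hβ
  · rw [← image_orbitSupp hA hb]
    exact ⟨_, ⟨_, hX, rfl⟩, orbitDiskEquiv_symm_apply hA hb α 0⟩

end Spectrum

end DGMod

end DG

theorem mainTheorem4 (A : DGRing.{u}) (hb : A.IsBounded) (hn : A.IsNonpositive)
    (hN : A.IsRightDGNoetherian) :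
    ∃ (hD : ∀ H : ModuleCat.{u} A.degZeroᵐᵒᵖ, IsMonoform H →
          ∀ n : ℤ, IsMonoform ((DGMod.D hn H)⟦n⟧))
      (e : AtomSpectrum (ModuleCat.{u} A.degZeroᵐᵒᵖ) × ℤ ≃ AtomSpectrum (DGMod A)),
      (∀ (H : ModuleCat.{u} A.degZeroᵐᵒᵖ) (hH : IsMonoform H) (n : ℤ),
        e (AtomSpectrum.mk H hH, n) = AtomSpectrum.mk ((DGMod.D hn H)⟦n⟧) (hD H hH n)) ∧
      ∃ φ : OrbitAtomSpectrum (DGMod A) ℤ ≃ₜ AtomSpectrum (ModuleCat.{u} A.degZeroᵐᵒᵖ),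
        (∀ (α : AtomSpectrum (ModuleCat.{u} A.degZeroᵐᵒᵖ)) (n : ℤ),
          φ (orbitProj ℤ (e (α, n))) = α) ∧
        ∀ M : DGMod A, φ '' orbitSupp ℤ M = atomSupp M.toDegZeroModule := by
  refine ⟨fun H hH n => DGMod.isMonoform_disk hn hH n,
    Equiv.ofBijective _ (DGMod.diskAtom_bijective hn hb), fun H hH n => rfl,
    ⟨(DGMod.orbitDiskEquiv hn hb).symm, DGMod.continuous_orbitDiskEquiv_symm hn hb,
      DGMod.continuous_orbitDiskEquiv hn hb⟩,
    fun α n => DGMod.orbitDiskEquiv_symm_apply hn hb α n, DGMod.image_orbitSupp hn hb⟩
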